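/- Let $X$ be a locally compact Hausdorff space with countable base. A boundary kernel for an open set $U\subset X$ is a kernel $T$ on $X$ (with its Borel $\sigma$-algebra $\mathcal B$) such that $T(x,X\setminus\partial U)=0$ for $x\in U$ and $T(x,\cdot)=\varepsilon_x$ (Dirac measure at $x$) for $x\in X\setminus U$; write $Tf(x)=\int f(y)\,T(x,dy)$. Let $\mathcal V$ be a base for the topology of $X$ consisting of relatively compact open sets, and for every $V\in\mathcal V$ let $H_V$ be a boundary kernel for $V$. For open $U$ let $\mathcal V(U):=\{V\in\mathcal V:\overline V\subset U\}$. A local choice in $U$ is a map $\mathcal W$ assigning to each $x\in U$ a fundamental system $\mathcal W(x)\subset\mathcal V(U)$ of neighborhoods of $x$. A lower semicontinuous function $u:U\to\,]-\infty,\infty]$ is $\mathcal W$-hyperharmonic on $U$ if $H_Wu(x)\le u(x)$ for all $x\in U$ and $W\in\mathcal W(x)$; it is hyperharmonic on $U$ if this holds for all $x\in U$ and all $W\in\mathcal V(U)$ with $x\in W$. A continuous function $h:U\to\mathbb R$ is harmonic on $U$ if $H_Vh=h$ on $V$ for all $V\in\mathcal V(U)$. (Throughout, "positive" means $\ge 0$.)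 Suppose that $(H_V)_{V\in\mathcal V}$ is a normal Bauer family of harmonic boundary kernels, that is, for every $V\in\mathcal V$: 1. $H_WH_V=H_V$ for all $W\in\mathcal V$ with $W\subset V$; 2. $H_V1=1$, and $H_Vf$ is continuous on $X$ for every continuous $f:X\to\mathbb R$; 3. there is a local choice $\mathcal W$ in $V$ such that the positive $\mathcal W$-hyperharmonic functions on $V$ separate the points of $V$; 4. $H_Vf$ is continuous on $V$ for every bounded Borel function $f$ on $X$. Suppose further that $(H_V)_{V\in\mathcal V}$ is elliptic: every positive harmonic function on a connected open set is identically zero or strictly positive there. Let $W\subset X$ be a $\mathcal P$-set, that is, an open set such that the positive hyperharmonic functions on $W$ separate the points of $W$. Call a relatively compact open set $U\subset X$ regular if every continuous $f:\partial U\to\mathbb R$ has a unique continuous extension to $\overline U$ which is harmonic on $U$, and this extension is positive whenever $f$ is positive. Then, for every compact $K\subset W$, there exists a regular neighborhood of $K$ in $W$, that is, a regular set $U$ with $K\subset U$ and $\overline U\subset W$. -/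

import Mathlib

open MeasureTheory ProbabilityTheory Topology Set

noncomputable section

namespace Bauer

/-- The integral of an extended real function, as integral of the positive part minus integral of
the negative part. It is only applied where the negative part has a finite integral. -/
def eintegral {X : Type*} [MeasurableSpace X] (μ : Measure X) (u : X → EReal) : EReal :=
  ((∫⁻ y, (u y).toENNReal ∂μ : ENNReal) : EReal) -
    ((∫⁻ y, (-u y).toENNReal ∂μ : ENNReal) : EReal)

variable {X : Type*} [TopologicalSpace X] [MeasurableSpace X]

/-- `T` is a boundary kernel for `U`: for `x ∈ U` the measure `T(x, ·)` does not charge the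
complement of `∂U`, and `T(x, ·)` is the Dirac measure at `x` for `x ∉ U`. -/
def IsBoundaryKernel (U : Set X) (T : Kernel X X) : Prop :=
  (∀ x ∈ U, T x (frontier U)ᶜ = 0) ∧ ∀ x ∉ U, T x = Measure.dirac x

/-- `𝒱(U)`: the members of `𝒱` with closure contained in `U`. -/
def inside (𝒱 : Set (Set X)) (U : Set X) : Set (Set X) :=
  {W | W ∈ 𝒱 ∧ closure W ⊆ U}

/-- `𝒲` is a local choice from `𝒱` in `U`: for `x ∈ U`, `𝒲 x` is a fundamental system of
neighborhoods of `x` consisting of sets in `𝒱(U)`. -/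
def IsLocalChoice (𝒱 : Set (Set X)) (U : Set X) (𝒲 : X → Set (Set X)) : Prop :=
  ∀ x ∈ U, 𝒲 x ⊆ inside 𝒱 U ∧ (𝓝 x).HasBasis (fun W : Set X => W ∈ 𝒲 x) id

/-- `𝒲`-hyperharmonic functions on `U`: lower semicontinuous functions `u` on `U` with values in
`]-∞, ∞]` such that `H_W u (x) ≤ u x` for all `x ∈ U` and `W ∈ 𝒲 x`. Functions on `U` are
represented by functions on `X`, whose values outside `U` play no role
(if `x ∈ W` and `closure W ⊆ U`, then `H_W(x, ·)` is carried by `∂W ⊆ U`). -/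
def HyperharmonicFor (H : Set X → Kernel X X) (𝒲 : X → Set (Set X)) (U : Set X)
    (u : X → EReal) : Prop :=
  (∀ x ∈ U, u x ≠ ⊥) ∧ LowerSemicontinuousOn u U ∧
    ∀ x ∈ U, ∀ W ∈ 𝒲 x, eintegral (H W x) u ≤ u x

/-- The hyperharmonic functions on `U`: here one takes all `W ∈ 𝒱(U)` containing the point. -/
def Hyperharmonic (𝒱 : Set (Set X)) (H : Set X → Kernel X X) (U : Set X) (u : X → EReal) : Prop :=
  HyperharmonicFor H (fun x => {W | W ∈ inside 𝒱 U ∧ x ∈ W}) U u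

/-- The harmonic functions on `U`: continuous real functions `h` on `U` such that `H_V h = h` on `V`
for all `V ∈ 𝒱(U)` (off `V` the equality is automatic, `H_V(x, ·)` being the Dirac measure). -/
def Harmonic (𝒱 : Set (Set X)) (H : Set X → Kernel X X) (U : Set X) (h : X → ℝ) : Prop :=
  ContinuousOn h U ∧ ∀ V ∈ inside 𝒱 U, ∀ x ∈ V, ∫ y, h y ∂(H V x) = h x

/-- A normal Bauer family `(H_V)`, `V ∈ 𝒱`, of harmonic boundary kernels on `X`.
Only the values `H V` with `V ∈ 𝒱` are relevant. -/
structure IsNormalBauerFamily (𝒱 : Set (Set X)) (H : Set X → Kernel X X) : Prop where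
  basis : TopologicalSpace.IsTopologicalBasis 𝒱
  compact_closure : ∀ V ∈ 𝒱, IsCompact (closure V)
  boundary : ∀ V ∈ 𝒱, IsBoundaryKernel V (H V)
  /-- `H_W H_V = H_V`, where `(H_W H_V)(x, ·) = ∫ H_V(y, ·) H_W(x, dy)`. -/
  compatible : ∀ V ∈ 𝒱, ∀ W ∈ 𝒱, W ⊆ V → (H V) ∘ₖ (H W) = H V
  /-- `H_V` maps continuous real functions to continuous functions. -/
  feller : ∀ V ∈ 𝒱, ∀ f : X → ℝ, Continuous f → Continuous fun x => ∫ y, f y ∂(H V x)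
  /-- `H_V 1 = 1`. -/
  normal : ∀ V ∈ 𝒱, ∀ x, H V x univ = 1
  /-- The positive `𝒲`-hyperharmonic functions on `V` separate the points of `V`, for some local
  choice `𝒲` in `V`. -/
  separation : ∀ V ∈ 𝒱, ∃ 𝒲 : X → Set (Set X), IsLocalChoice 𝒱 V 𝒲 ∧
    ∀ x ∈ V, ∀ y ∈ V, x ≠ y →
      ∃ u : X → EReal, HyperharmonicFor H 𝒲 V u ∧ (∀ z ∈ V, 0 ≤ u z) ∧ u x ≠ u y
  /-- `H_V f` is continuous on `V` for every bounded Borel function `f`. -/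
  strong_feller : ∀ V ∈ 𝒱, ∀ f : X → ℝ, Measurable f → (∃ C, ∀ x, |f x| ≤ C) →
    ContinuousOn (fun x => ∫ y, f y ∂(H V x)) V

/-- `𝒫`-sets: open sets `U` such that the positive hyperharmonic functions on `U` separate the
points of `U`. -/
def IsPSet (𝒱 : Set (Set X)) (H : Set X → Kernel X X) (U : Set X) : Prop :=
  IsOpen U ∧ ∀ x ∈ U, ∀ y ∈ U, x ≠ y →
    ∃ u : X → EReal, Hyperharmonic 𝒱 H U u ∧ (∀ z ∈ U, 0 ≤ u z) ∧ u x ≠ u y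

/-- Regular sets: relatively compact open sets `U` such that every continuous real function `f` on
`∂U` has a unique continuous extension to `closure U` which is harmonic on `U`, and this extension
is positive if `f` is positive. -/
def IsRegular (𝒱 : Set (Set X)) (H : Set X → Kernel X X) (U : Set X) : Prop :=
  IsOpen U ∧ IsCompact (closure U) ∧
    ∀ f : X → ℝ, ContinuousOn f (frontier U) →
      ∃ h : X → ℝ,
        (ContinuousOn h (closure U) ∧ EqOn h f (frontier U) ∧ Harmonic 𝒱 H U h) ∧
        (∀ h' : X → ℝ, ContinuousOn h' (closure U) → EqOn h' f (frontier U) →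
          Harmonic 𝒱 H U h' → EqOn h' h (closure U)) ∧
        ((∀ z ∈ frontier U, 0 ≤ f z) → ∀ x ∈ closure U, 0 ≤ h x)

/-- Ellipticity: every positive harmonic function on a connected open set is identically zero
or strictly positive. -/
def IsElliptic (𝒱 : Set (Set X)) (H : Set X → Kernel X X) : Prop :=
  ∀ U : Set X, IsOpen U → IsConnected U → ∀ h : X → ℝ, Harmonic 𝒱 H U h →
    (∀ x ∈ U, 0 ≤ h x) → (∀ x ∈ U, h x = 0) ∨ ∀ x ∈ U, 0 < h x

end Bauer

end

/-!
In a `𝒫`-set there is a minimum principle: the set where a lower semicontinuous superharmonic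
function attains a negative minimum is compact and absorbing. Superharmonic functions are constant
on a minimal absorbing subset, which is therefore a single point, but a boundary kernel charges the
complement of that point.

Reduced functions, the smallest superharmonic functions with given lower bounds, are harmonic where
these bounds are not active. By ellipticity, every point of `W` has arbitrarily small closed
neighborhoods `{q ≥ a}`, where `q` is the potential of a bump function, and `a - q` is a barrier at
their boundary points. Taking away finitely many of these sets, which cover the boundary of a
neighborhood of `K`, leaves a neighborhood `U` of `K` with a barrier at each boundary point.

If `p` is continuous and superharmonic on `W`, the Dirichlet problem on `U` with boundary values
`-p` is solved by a reduced function. By the Stone–Weierstrass theorem, differences of such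
functions are dense in the continuous functions on `∂U`, and by the minimum principle the solvable
boundary functions are closed under uniform limits.
-/

namespace Bauer

open Filter

open scoped BoundedContinuousFunction

section Kernels

variable {X : Type*} [MeasurableSpace X]

/-- The function `Tf : x ↦ ∫ f(y) T(x, dy)`. -/
noncomputable def sweep (T : Kernel X X) (f : X → ℝ) (x : X) : ℝ := ∫ y, f y ∂(T x)

/-- Bounded Borel functions, the class of functions on which kernels act by `sweep`. -/
structure IsBoundedBorel (f : X → ℝ) : Prop where
  measurable : Measurable f
  bounded : ∃ C, ∀ x, |f x| ≤ C

variable {T S : Kernel X X} {f g : X → ℝ}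

theorem abs_sweep_le [IsMarkovKernel T] {C : ℝ} (hC : ∀ y, |f y| ≤ C) (x : X) :
    |sweep T f x| ≤ C := by
  simpa [sweep] using norm_integral_le_of_norm_le_const (μ := T x) (f := f) (.of_forall hC)

namespace IsBoundedBorel

theorem const (c : ℝ) : IsBoundedBorel fun _ : X => c :=
  ⟨measurable_const, |c|, fun _ => le_rfl⟩

theorem add (hf : IsBoundedBorel f) (hg : IsBoundedBorel g) :
    IsBoundedBorel fun x => f x + g x := by
  obtain ⟨C, hC⟩ := hf.bounded
  obtain ⟨D, hD⟩ := hg.bounded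
  exact ⟨hf.measurable.add hg.measurable, C + D,
    fun x => (abs_add_le _ _).trans (add_le_add (hC x) (hD x))⟩

theorem const_mul (c : ℝ) (hf : IsBoundedBorel f) : IsBoundedBorel fun x => c * f x := by
  obtain ⟨C, hC⟩ := hf.bounded
  exact ⟨hf.measurable.const_mul c, |c| * C,
    fun x => (abs_mul c _).trans_le (mul_le_mul_of_nonneg_left (hC x) (abs_nonneg c))⟩

theorem sub (hf : IsBoundedBorel f) (hg : IsBoundedBorel g) :
    IsBoundedBorel fun x => f x - g x := by
  simpa [sub_eq_add_neg] using hf.add (hg.const_mul (-1))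

theorem min (hf : IsBoundedBorel f) (hg : IsBoundedBorel g) :
    IsBoundedBorel fun x => min (f x) (g x) := by
  obtain ⟨C, hC⟩ := hf.bounded
  obtain ⟨D, hD⟩ := hg.bounded
  exact ⟨hf.measurable.min hg.measurable, max C D,
    fun x => abs_min_le_max_abs_abs.trans (max_le_max (hC x) (hD x))⟩

theorem sweep [IsMarkovKernel T] (hf : IsBoundedBorel f) : IsBoundedBorel (sweep T f) :=
  ⟨(hf.measurable.stronglyMeasurable.integral_kernel (κ := T)).measurable,
    hf.bounded.imp fun _ => abs_sweep_le⟩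

theorem integrable (hf : IsBoundedBorel f) (μ : Measure X) [IsFiniteMeasure μ] :
    Integrable f μ := by
  obtain ⟨C, hC⟩ := hf.bounded
  exact .of_bound hf.measurable.aestronglyMeasurable C (.of_forall hC)

end IsBoundedBorel

theorem isBoundedBorel_indicator {s : Set X} (hs : MeasurableSet s) (c : ℝ) :
    IsBoundedBorel (s.indicator fun _ => c) :=
  ⟨measurable_const.indicator hs, |c|, fun _ => norm_indicator_le_norm_self (fun _ => c) _⟩

theorem sweep_const [IsMarkovKernel T] (c : ℝ) (x : X) : sweep T (fun _ => c) x = c := by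
  simp [sweep]

theorem sweep_const_mul (c : ℝ) (f : X → ℝ) (x : X) :
    sweep T (fun y => c * f y) x = c * sweep T f x := integral_const_mul c f

theorem sweep_add [IsFiniteKernel T] (hf : IsBoundedBorel f) (hg : IsBoundedBorel g) (x : X) :
    sweep T (fun y => f y + g y) x = sweep T f x + sweep T g x :=
  integral_add (hf.integrable _) (hg.integrable _)

theorem sweep_sub [IsFiniteKernel T] (hf : IsBoundedBorel f) (hg : IsBoundedBorel g) (x : X) :
    sweep T (fun y => f y - g y) x = sweep T f x - sweep T g x :=
  integral_sub (hf.integrable _) (hg.integrable _)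

theorem sweep_mono [IsFiniteKernel T] (hf : IsBoundedBorel f) (hg : IsBoundedBorel g)
    (h : ∀ y, f y ≤ g y) (x : X) : sweep T f x ≤ sweep T g x :=
  integral_mono (hf.integrable _) (hg.integrable _) h

theorem sweep_sweep [IsFiniteKernel S] (h : S ∘ₖ T = S) (hf : IsBoundedBorel f) (x : X) :
    sweep T (sweep S f) x = sweep S f x := by
  have key := Kernel.integral_comp (a := x) (κ := T) (η := S) (f := f)
    (h.symm ▸ hf.integrable (S x))
  exact key.symm.trans (by rw [h, sweep])

theorem tendsto_sweep [IsFiniteKernel T] {F : ℕ → X → ℝ} (hF : ∀ n, Measurable (F n)) {C : ℝ}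
    (hC : ∀ n y, |F n y| ≤ C) (h : ∀ y, Tendsto (fun n => F n y) atTop (𝓝 (f y))) (x : X) :
    Tendsto (fun n => sweep T (F n) x) atTop (𝓝 (sweep T f x)) :=
  tendsto_integral_of_dominated_convergence (fun _ => C)
    (fun n => (hF n).aestronglyMeasurable) (integrable_const C) (fun n => .of_forall (hC n))
    (.of_forall h)

end Kernels

section BoundaryKernels

variable {X : Type*} [TopologicalSpace X] [MeasurableSpace X] {V : Set X} {T : Kernel X X}
  {f g : X → ℝ} {x : X}

theorem IsBoundedBorel.of_boundedContinuous [OpensMeasurableSpace X] (φ : X →ᵇ ℝ) :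
    IsBoundedBorel φ :=
  ⟨φ.continuous.measurable, ‖φ‖, φ.norm_coe_le_norm⟩

namespace IsBoundaryKernel

theorem ae_mem_frontier (hT : IsBoundaryKernel V T) (hx : x ∈ V) :
    ∀ᵐ y ∂(T x), y ∈ frontier V := hT.1 x hx

theorem sweep_of_notMem [T2Space X] [BorelSpace X] (hT : IsBoundaryKernel V T) (hx : x ∉ V)
    (f : X → ℝ) : sweep T f x = f x := by
  rw [sweep, hT.2 x hx, integral_dirac]

theorem sweep_congr (hT : IsBoundaryKernel V T) (hx : x ∈ V) (h : EqOn f g (frontier V)) :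
    sweep T f x = sweep T g x :=
  integral_congr_ae ((hT.ae_mem_frontier hx).mono h)

theorem sweep_le_sweep [IsFiniteKernel T] (hT : IsBoundaryKernel V T) (hx : x ∈ V)
    (hf : IsBoundedBorel f) (hg : IsBoundedBorel g) (h : ∀ y ∈ frontier V, f y ≤ g y) :
    sweep T f x ≤ sweep T g x :=
  integral_mono_ae (hf.integrable _) (hg.integrable _) ((hT.ae_mem_frontier hx).mono h)

theorem integrable_of_continuousOn [T2Space X] [BorelSpace X] [IsFiniteKernel T]
    (hT : IsBoundaryKernel V T) (hc : IsCompact (frontier V)) (hx : x ∈ V)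
    (hf : ContinuousOn f (frontier V)) : Integrable f (T x) := by
  have := hf.integrableOn_compact (μ := T x) hc
  rwa [IntegrableOn, Measure.restrict_eq_self_of_ae_mem (hT.ae_mem_frontier hx)] at this

end IsBoundaryKernel

end BoundaryKernels

section Absorbing

variable {X : Type*} [MeasurableSpace X] {𝒩 : X → Set (Measure X)} {F M : Set X}

/-- `F` is absorbing for a family `𝒩` of measures attached to the points of `X` if every measure
attached to a point of `F` is carried by `F`. -/
def IsAbsorbing (𝒩 : X → Set (Measure X)) (F : Set X) : Prop :=
  ∀ x ∈ F, ∀ μ ∈ 𝒩 x, ∀ᵐ y ∂μ, y ∈ F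

theorem IsAbsorbing.inter_preimage_Iic {w : X → ℝ} {m : ℝ} (hF : IsAbsorbing 𝒩 F)
    (hm : ∀ y ∈ F, m ≤ w y) (hp : ∀ x ∈ F, ∀ μ ∈ 𝒩 x, IsProbabilityMeasure μ)
    (hi : ∀ x ∈ F, ∀ μ ∈ 𝒩 x, Integrable w μ) (hw : ∀ x ∈ F, ∀ μ ∈ 𝒩 x, ∫ y, w y ∂μ ≤ w x) :
    IsAbsorbing 𝒩 (F ∩ w ⁻¹' Iic m) := by
  rintro x ⟨hxF, hxm⟩ μ hμ
  have := hp x hxF μ hμ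
  have hnonneg : 0 ≤ᵐ[μ] fun y => w y - m :=
    (hF x hxF μ hμ).mono fun y hy => sub_nonneg.2 (hm y hy)
  have hint : Integrable (fun y => w y - m) μ := (hi x hxF μ hμ).sub (integrable_const m)
  have hzero : ∫ y, (w y - m) ∂μ = 0 := by
    refine le_antisymm ?_ (integral_nonneg_of_ae hnonneg)
    rw [integral_sub (hi x hxF μ hμ) (integrable_const m)]
    simpa using (hw x hxF μ hμ).trans hxm
  filter_upwards [hF x hxF μ hμ, (integral_eq_zero_iff_of_nonneg_ae hnonneg hint).1 hzero]
    with y hyF hy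
  exact ⟨hyF, (sub_eq_zero.1 hy).le⟩

variable [TopologicalSpace X] [SecondCountableTopology X]

theorem IsAbsorbing.sInter {c : Set (Set X)} (hcl : ∀ F ∈ c, IsClosed F)
    (hc : ∀ F ∈ c, IsAbsorbing 𝒩 F) : IsAbsorbing 𝒩 (⋂₀ c) := by
  intro x hx μ hμ
  obtain ⟨S, hS, hSc, hSU⟩ := TopologicalSpace.isOpen_sUnion_countable (compl '' c) (by
    rintro _ ⟨F, hF, rfl⟩
    exact (hcl F hF).isOpen_compl)
  change μ (⋂₀ c)ᶜ = 0
  rw [compl_sInter, ← hSU, measure_sUnion_null_iff hS]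
  intro s hs
  obtain ⟨F, hF, rfl⟩ := hSc hs
  exact hc F hF x (hx F hF) μ hμ

theorem exists_minimal_isAbsorbing (hM : IsCompact M) (hMc : IsClosed M) (hne : M.Nonempty)
    (hMa : IsAbsorbing 𝒩 M) :
    ∃ F, Minimal (fun F => F.Nonempty ∧ IsClosed F ∧ F ⊆ M ∧ IsAbsorbing 𝒩 F) F := by
  refine (zorn_superset_nonempty {F | F.Nonempty ∧ IsClosed F ∧ F ⊆ M ∧ IsAbsorbing 𝒩 F}
    (fun c hcS hchain hcne => ?_) M ⟨hne, hMc, subset_rfl, hMa⟩).imp fun F hF => hF.2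
  refine ⟨⋂₀ c, ⟨?_, isClosed_sInter fun s hs => (hcS hs).2.1, ?_, ?_⟩,
    fun s hs => sInter_subset_of_mem hs⟩
  · have := hcne.to_subtype
    exact IsCompact.nonempty_sInter_of_directed_nonempty_isCompact_isClosed
      (fun s hs t ht => (hchain.total hs ht).elim (fun h => ⟨s, hs, subset_rfl, h⟩)
        fun h => ⟨t, ht, h, subset_rfl⟩) (fun s hs => (hcS hs).1)
      (fun s hs => hM.of_isClosed_subset (hcS hs).2.1 (hcS hs).2.2.1) fun s hs => (hcS hs).2.1
  · obtain ⟨s, hs⟩ := hcne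
    exact (sInter_subset_of_mem hs).trans (hcS hs).2.2.1
  · exact .sInter (fun s hs => (hcS hs).2.1) fun s hs => (hcS hs).2.2.2

/-- Cutting a minimal absorbing set `F` at the minimum of `w` on `F` gives an absorbing set, so `w`
is constant on `F`. -/
theorem exists_ae_eq_of_separating (hM : IsCompact M) (hMc : IsClosed M) (hne : M.Nonempty)
    (hMa : IsAbsorbing 𝒩 M) (hp : ∀ x ∈ M, ∀ μ ∈ 𝒩 x, IsProbabilityMeasure μ)
    (hsep : ∀ x ∈ M, ∀ y ∈ M, x ≠ y → ∃ w : X → ℝ, LowerSemicontinuousOn w M ∧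
      (∀ x ∈ M, ∀ μ ∈ 𝒩 x, Integrable w μ ∧ ∫ z, w z ∂μ ≤ w x) ∧ w x ≠ w y) :
    ∃ x ∈ M, ∀ μ ∈ 𝒩 x, ∀ᵐ y ∂μ, y = x := by
  obtain ⟨F, hF⟩ := exists_minimal_isAbsorbing hM hMc hne hMa
  obtain ⟨⟨x, hxF⟩, hFc, hFM, hFa⟩ := hF.prop
  have hsub : F.Subsingleton := by
    intro x hx y hy
    by_contra hxy
    obtain ⟨w, hwM, hwi, hne⟩ := hsep x (hFM hx) y (hFM hy) hxy
    have hwF := hwM.mono hFM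
    obtain ⟨a, haF, ha⟩ := hwF.exists_isMinOn ⟨x, hx⟩ (hM.of_isClosed_subset hFc hFM)
    obtain ⟨v, hv, hvF⟩ := lowerSemicontinuousOn_iff_preimage_Iic.1 hwF (w a)
    have hcut : IsAbsorbing 𝒩 (F ∩ w ⁻¹' Iic (w a)) := hFa.inter_preimage_Iic (fun z hz => ha hz)
      (fun z hz => hp z (hFM hz)) (fun z hz μ hμ => (hwi z (hFM hz) μ hμ).1)
      fun z hz μ hμ => (hwi z (hFM hz) μ hμ).2
    have hle : F ⊆ F ∩ w ⁻¹' Iic (w a) := hF.le_of_le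
      ⟨⟨a, haF, le_refl (w a)⟩, hvF ▸ hFc.inter hv, inter_subset_left.trans hFM, hcut⟩
      inter_subset_left
    have hconst : ∀ z ∈ F, w z = w a := fun z hz => le_antisymm (hle hz).2 (ha hz)
    exact hne ((hconst x hx).trans (hconst y hy).symm)
  exact ⟨x, hFM hxF, fun μ hμ => (hFa x hxF μ hμ).mono fun y hy => hsub hy hxF⟩

end Absorbing

section Topology

variable {X : Type*} [TopologicalSpace X] {𝒱 : Set (Set X)} {U V : Set X}

theorem inside_mono (h : U ⊆ V) : inside 𝒱 U ⊆ inside 𝒱 V := fun _ hB => ⟨hB.1, hB.2.trans h⟩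

theorem lowerSemicontinuous_indicator {s : X → ℝ} (hU : IsOpen U) (hs : LowerSemicontinuousOn s U)
    (hs0 : ∀ x ∈ U, 0 ≤ s x) : LowerSemicontinuous (U.indicator s) := by
  intro x c hc
  have hpos : ∀ y, 0 ≤ U.indicator s y := fun y => indicator_nonneg hs0 y
  by_cases hx : x ∈ U
  · rw [indicator_of_mem hx] at hc
    have := hs x hx c hc
    rw [hU.nhdsWithin_eq hx] at this
    filter_upwards [this, hU.mem_nhds hx] with y hy hyU
    rwa [indicator_of_mem hyU]
  · rw [indicator_of_notMem hx] at hc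
    exact .of_forall fun y => hc.trans_le (hpos y)

end Topology

section Superharmonic

variable {X : Type*} [TopologicalSpace X] [MeasurableSpace X] {𝒱 : Set (Set X)}
  {H : Set X → Kernel X X} {U V W Ω : Set X}

namespace IsNormalBauerFamily

theorem isOpen (hN : IsNormalBauerFamily 𝒱 H) (hV : V ∈ 𝒱) : IsOpen V := hN.basis.isOpen hV

theorem isMarkovKernel (hN : IsNormalBauerFamily 𝒱 H) (hV : V ∈ 𝒱) : IsMarkovKernel (H V) :=
  ⟨fun x => ⟨hN.normal V hV x⟩⟩

theorem isCompact_frontier (hN : IsNormalBauerFamily 𝒱 H) (hV : V ∈ 𝒱) : IsCompact (frontier V) :=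
  (hN.compact_closure V hV).of_isClosed_subset isClosed_frontier frontier_subset_closure

theorem frontier_nonempty (hN : IsNormalBauerFamily 𝒱 H) (hV : V ∈ 𝒱) {x : X} (hx : x ∈ V) :
    (frontier V).Nonempty :=
  have := hN.isMarkovKernel hV
  ((hN.boundary V hV).ae_mem_frontier hx).exists

theorem exists_mem_closure_subset [T2Space X] [LocallyCompactSpace X]
    (hN : IsNormalBauerFamily 𝒱 H) {x : X} {N : Set X} (hx : N ∈ 𝓝 x) :
    ∃ V ∈ 𝒱, x ∈ V ∧ closure V ⊆ N := by
  obtain ⟨C, hC, hCc, hCN⟩ := exists_mem_nhds_isClosed_subset hx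
  obtain ⟨V, hV, hxV, hVC⟩ := hN.basis.mem_nhds_iff.1 hC
  exact ⟨V, hV, hxV, (closure_minimal hVC hCc).trans hCN⟩

end IsNormalBauerFamily

/-- Bounded Borel functions on `X` which are superharmonic on `Ω`. -/
structure IsSuperharmonic (𝒱 : Set (Set X)) (H : Set X → Kernel X X) (Ω : Set X)
    (s : X → ℝ) : Prop where
  isBoundedBorel : IsBoundedBorel s
  lowerSemicontinuousOn : LowerSemicontinuousOn s Ω
  sweep_le : ∀ V ∈ inside 𝒱 Ω, ∀ x ∈ V, sweep (H V) s x ≤ s x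

/-- Bounded Borel functions on `X` which are lower semicontinuous on `Ω` and, at every `x ∈ Ω`,
satisfy `H_V s (x) ≤ s x` for arbitrarily small `V ∋ x`. -/
structure IsLocallySuperharmonic (𝒱 : Set (Set X)) (H : Set X → Kernel X X) (Ω : Set X)
    (s : X → ℝ) : Prop where
  isBoundedBorel : IsBoundedBorel s
  lowerSemicontinuousOn : LowerSemicontinuousOn s Ω
  exists_sweep_le : ∀ x ∈ Ω, ∀ N ∈ 𝓝 x, ∃ V ∈ 𝒱, x ∈ V ∧ closure V ⊆ N ∧ sweep (H V) s x ≤ s x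

variable {s t : X → ℝ}

theorem isSuperharmonic_const (hN : IsNormalBauerFamily 𝒱 H) (c : ℝ) :
    IsSuperharmonic 𝒱 H Ω fun _ => c :=
  ⟨.const c, lowerSemicontinuousOn_const, fun _ hV x _ =>
    have := hN.isMarkovKernel hV.1
    (sweep_const c x).le⟩

namespace IsSuperharmonic

theorem mono (hs : IsSuperharmonic 𝒱 H Ω s) (hU : U ⊆ Ω) : IsSuperharmonic 𝒱 H U s :=
  ⟨hs.isBoundedBorel, hs.lowerSemicontinuousOn.mono hU,
    fun V hV => hs.sweep_le V (inside_mono hU hV)⟩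

theorem add (hs : IsSuperharmonic 𝒱 H Ω s) (ht : IsSuperharmonic 𝒱 H Ω t)
    (hN : IsNormalBauerFamily 𝒱 H) : IsSuperharmonic 𝒱 H Ω fun x => s x + t x := by
  refine ⟨hs.isBoundedBorel.add ht.isBoundedBorel,
    hs.lowerSemicontinuousOn.add ht.lowerSemicontinuousOn, fun V hV x hx => ?_⟩
  have := hN.isMarkovKernel hV.1
  exact (sweep_add hs.isBoundedBorel ht.isBoundedBorel x).trans_le
    (add_le_add (hs.sweep_le V hV x hx) (ht.sweep_le V hV x hx))

theorem const_mul (hs : IsSuperharmonic 𝒱 H Ω s) {c : ℝ} (hc : 0 ≤ c) :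
    IsSuperharmonic 𝒱 H Ω fun x => c * s x :=
  ⟨hs.isBoundedBorel.const_mul c,
    (continuous_const_mul c).comp_lowerSemicontinuousOn hs.lowerSemicontinuousOn
      fun _ _ h => mul_le_mul_of_nonneg_left h hc,
    fun V hV x hx => (sweep_const_mul c s x).trans_le
      (mul_le_mul_of_nonneg_left (hs.sweep_le V hV x hx) hc)⟩

theorem inf (hs : IsSuperharmonic 𝒱 H Ω s) (ht : IsSuperharmonic 𝒱 H Ω t)
    (hN : IsNormalBauerFamily 𝒱 H) : IsSuperharmonic 𝒱 H Ω fun x => min (s x) (t x) := by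
  have hst := hs.isBoundedBorel.min ht.isBoundedBorel
  refine ⟨hst, hs.lowerSemicontinuousOn.inf ht.lowerSemicontinuousOn, fun V hV x hx => ?_⟩
  have := hN.isMarkovKernel hV.1
  exact le_min
    ((sweep_mono hst hs.isBoundedBorel (fun _ => min_le_left _ _) x).trans (hs.sweep_le V hV x hx))
    ((sweep_mono hst ht.isBoundedBorel (fun _ => min_le_right _ _) x).trans (ht.sweep_le V hV x hx))

theorem isLocallySuperharmonic [T2Space X] [LocallyCompactSpace X] (hs : IsSuperharmonic 𝒱 H Ω s)
    (hN : IsNormalBauerFamily 𝒱 H) (hΩ : IsOpen Ω) : IsLocallySuperharmonic 𝒱 H Ω s := by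
  refine ⟨hs.isBoundedBorel, hs.lowerSemicontinuousOn, fun x hx N hNx => ?_⟩
  obtain ⟨V, hV, hxV, hVN⟩ := hN.exists_mem_closure_subset (inter_mem hNx (hΩ.mem_nhds hx))
  exact ⟨V, hV, hxV, hVN.trans inter_subset_left,
    hs.sweep_le V ⟨hV, hVN.trans inter_subset_right⟩ x hxV⟩

/-- Replacing a superharmonic function by a smaller one inside `V` keeps it superharmonic: the two
functions are only compared near points of `V`, and off `V` the minimum is the original one. -/
theorem isLocallySuperharmonic_min [T2Space X] [LocallyCompactSpace X]
    (hs : IsSuperharmonic 𝒱 H Ω s) (ht : IsSuperharmonic 𝒱 H (Ω ∩ V) t)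
    (hN : IsNormalBauerFamily 𝒱 H) (hΩ : IsOpen Ω) (hV : IsOpen V)
    (htl : LowerSemicontinuousOn t Ω) (hst : ∀ x ∈ Ω \ V, s x ≤ t x) :
    IsLocallySuperharmonic 𝒱 H Ω fun x => min (s x) (t x) := by
  have hbdd := hs.isBoundedBorel.min ht.isBoundedBorel
  refine ⟨hbdd, hs.lowerSemicontinuousOn.inf htl, fun x hx N hNx => ?_⟩
  by_cases hxV : x ∈ V
  · obtain ⟨B, hB, hxB, hBN⟩ := hN.exists_mem_closure_subset
      (inter_mem hNx ((hΩ.inter hV).mem_nhds ⟨hx, hxV⟩))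
    exact ⟨B, hB, hxB, hBN.trans inter_subset_left, ((hs.mono inter_subset_left).inf ht hN).sweep_le
      B ⟨hB, hBN.trans inter_subset_right⟩ x hxB⟩
  · obtain ⟨B, hB, hxB, hBN⟩ := hN.exists_mem_closure_subset (inter_mem hNx (hΩ.mem_nhds hx))
    have := hN.isMarkovKernel hB
    refine ⟨B, hB, hxB, hBN.trans inter_subset_left, ?_⟩
    rw [min_eq_left (hst x ⟨hx, hxV⟩)]
    exact (sweep_mono hbdd hs.isBoundedBorel (fun _ => min_le_left _ _) x).trans
      (hs.sweep_le B ⟨hB, hBN.trans inter_subset_right⟩ x hxB)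

end IsSuperharmonic

theorem isSuperharmonic_indicator_toReal_min [OpensMeasurableSpace X]
    (hN : IsNormalBauerFamily 𝒱 H) (hΩ : IsOpen Ω) {w : X → ENNReal}
    (hw : LowerSemicontinuousOn w Ω)
    (hwle : ∀ V ∈ inside 𝒱 Ω, ∀ x ∈ V, ∫⁻ y, w y ∂(H V x) ≤ w x) (r : NNReal) :
    IsSuperharmonic 𝒱 H Ω (Ω.indicator fun x => (min (w x) r).toReal) := by
  set s : X → ℝ := fun x => (min (w x) r).toReal
  have hfin : ∀ a : ENNReal, min a r ≠ ⊤ := fun a => (min_lt_of_right_lt ENNReal.coe_lt_top).ne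
  have hcont : Continuous fun a : ENNReal => (min a r).toReal :=
    ENNReal.continuousOn_toReal.comp_continuous (continuous_id.min continuous_const) hfin
  have hlsc : LowerSemicontinuous (Ω.indicator s) := lowerSemicontinuous_indicator hΩ
    (hcont.comp_lowerSemicontinuousOn hw fun a b hab =>
      ENNReal.toReal_mono (hfin b) (min_le_min_right _ hab)) fun _ _ => ENNReal.toReal_nonneg
  have hbdd : ∀ x, |Ω.indicator s x| ≤ r := fun x => by
    refine (norm_indicator_le_norm_self s x).trans ?_
    rw [Real.norm_of_nonneg ENNReal.toReal_nonneg]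
    exact ENNReal.toReal_mono ENNReal.coe_ne_top (min_le_right _ _)
  refine ⟨⟨hlsc.measurable, r, hbdd⟩, hlsc.lowerSemicontinuousOn Ω, fun V hV x hx => ?_⟩
  have hmark := hN.isMarkovKernel hV.1
  have hfr : ∀ᵐ y ∂(H V x), y ∈ Ω := ((hN.boundary V hV.1).ae_mem_frontier hx).mono
    fun y hy => hV.2 (frontier_subset_closure hy)
  rw [indicator_of_mem (hV.2 (subset_closure hx)), sweep,
    integral_eq_lintegral_of_nonneg_ae (.of_forall fun y =>
      indicator_nonneg (fun _ _ => ENNReal.toReal_nonneg) y) hlsc.measurable.aestronglyMeasurable]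
  refine ENNReal.toReal_mono (hfin _) ?_
  have hae : ∀ᵐ y ∂(H V x), ENNReal.ofReal (Ω.indicator s y) = min (w y) r :=
    hfr.mono fun y hy => by rw [indicator_of_mem hy, ENNReal.ofReal_toReal (hfin _)]
  rw [lintegral_congr_ae hae]
  refine le_min ((lintegral_mono fun _ => min_le_left _ _).trans (hwle V hV x hx)) ?_
  exact (lintegral_mono fun _ => min_le_right _ _).trans (by simp)

theorem Hyperharmonic.lintegral_toENNReal_le (hN : IsNormalBauerFamily 𝒱 H) {v : X → EReal}
    (hv : Hyperharmonic 𝒱 H Ω v) (hv0 : ∀ x ∈ Ω, 0 ≤ v x) (hV : V ∈ inside 𝒱 Ω) {x : X}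
    (hx : x ∈ V) : ∫⁻ y, (v y).toENNReal ∂(H V x) ≤ (v x).toENNReal := by
  have hneg : ∫⁻ y, (-v y).toENNReal ∂(H V x) = 0 := by
    rw [lintegral_congr_ae (g := fun _ => 0), lintegral_zero]
    filter_upwards [(hN.boundary V hV.1).ae_mem_frontier hx] with y hy
    exact EReal.toENNReal_of_nonpos
      (EReal.neg_le_zero.2 (hv0 y (hV.2 (frontier_subset_closure hy))))
  have hle := hv.2.2 x (hV.2 (subset_closure hx)) V ⟨hV, hx⟩
  rw [eintegral, hneg, EReal.coe_ennreal_zero, sub_zero] at hle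
  simpa using EReal.toENNReal_le_toENNReal hle

theorem IsPSet.exists_isSuperharmonic_ne [OpensMeasurableSpace X] (hW : IsPSet 𝒱 H W)
    (hN : IsNormalBauerFamily 𝒱 H) {x y : X} (hx : x ∈ W) (hy : y ∈ W) (hxy : x ≠ y) :
    ∃ s : X → ℝ, IsSuperharmonic 𝒱 H W s ∧ (∀ z, 0 ≤ s z) ∧ s x ≠ s y := by
  obtain ⟨v, hv, hv0, hne⟩ := hW.2 x hx y hy hxy
  have hne' : (v x).toENNReal ≠ (v y).toENNReal := fun h => hne <| by
    rw [← EReal.coe_toENNReal (hv0 x hx), h, EReal.coe_toENNReal (hv0 y hy)]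
  obtain ⟨r, hr⟩ : ∃ r : NNReal, min (v x).toENNReal r ≠ min (v y).toENNReal r := by
    rcases lt_or_gt_of_ne hne' with h | h <;>
      obtain ⟨r, h1, h2⟩ := ENNReal.lt_iff_exists_nnreal_btwn.1 h
    · exact ⟨r, by rw [min_eq_left h1.le, min_eq_right h2.le]; exact h1.ne⟩
    · exact ⟨r, by rw [min_eq_right h2.le, min_eq_left h1.le]; exact h1.ne'⟩
  refine ⟨_, isSuperharmonic_indicator_toReal_min hN hW.1
    (EReal.continuous_toENNReal.comp_lowerSemicontinuousOn hv.2.1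
      fun _ _ h => EReal.toENNReal_le_toENNReal h)
    (fun V hV x hx => hv.lintegral_toENNReal_le hN hv0 hV hx) r,
    fun z => indicator_nonneg (fun _ _ => ENNReal.toReal_nonneg) z, ?_⟩
  rw [indicator_of_mem hx, indicator_of_mem hy]
  have hfin : ∀ a : ENNReal, min a r ≠ ⊤ := fun a => (min_lt_of_right_lt ENNReal.coe_lt_top).ne
  exact fun h => hr ((ENNReal.toReal_eq_toReal_iff' (hfin _) (hfin _)).1 h)

section MinimumPrinciple

variable [T2Space X] [SecondCountableTopology X] [BorelSpace X]

theorem IsPSet.not_isAbsorbing (hW : IsPSet 𝒱 H W) (hN : IsNormalBauerFamily 𝒱 H) {M : Set X}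
    (hM : IsCompact M) (hne : M.Nonempty) (hMW : M ⊆ W) {𝒩 : X → Set (Measure X)}
    (h𝒩 : ∀ x, ∀ μ ∈ 𝒩 x, ∃ V ∈ inside 𝒱 W, x ∈ V ∧ μ = H V x)
    (h𝒩ne : ∀ x ∈ M, (𝒩 x).Nonempty) : ¬ IsAbsorbing 𝒩 M := by
  intro hMa
  have hp : ∀ x ∈ M, ∀ μ ∈ 𝒩 x, IsProbabilityMeasure μ := fun x _ μ hμ => by
    obtain ⟨V, hV, -, rfl⟩ := h𝒩 x μ hμ
    exact (hN.isMarkovKernel hV.1).isProbabilityMeasure x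
  have hsep : ∀ x ∈ M, ∀ y ∈ M, x ≠ y → ∃ w : X → ℝ, LowerSemicontinuousOn w M ∧
      (∀ x ∈ M, ∀ μ ∈ 𝒩 x, Integrable w μ ∧ ∫ z, w z ∂μ ≤ w x) ∧ w x ≠ w y := by
    intro x hx y hy hxy
    obtain ⟨w, hw, -, hne⟩ := hW.exists_isSuperharmonic_ne hN (hMW hx) (hMW hy) hxy
    refine ⟨w, hw.lowerSemicontinuousOn.mono hMW, fun z hz μ hμ => ?_, hne⟩
    have := hp z hz μ hμ
    obtain ⟨V, hV, hzV, rfl⟩ := h𝒩 z μ hμ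
    exact ⟨hw.isBoundedBorel.integrable _, hw.sweep_le V hV z hzV⟩
  obtain ⟨x, hxM, hx⟩ := exists_ae_eq_of_separating hM hM.isClosed hne hMa hp hsep
  obtain ⟨μ, hμ⟩ := h𝒩ne x hxM
  have := hp x hxM μ hμ
  obtain ⟨V, hV, hxV, rfl⟩ := h𝒩 x μ hμ
  obtain ⟨y, hy, rfl⟩ :=
    (((hN.boundary V hV.1).ae_mem_frontier hxV).and (hx _ hμ)).exists
  exact ((hN.isOpen hV.1).frontier_eq ▸ hy).2 hxV

theorem minimum_principle (hN : IsNormalBauerFamily 𝒱 H) (hW : IsPSet 𝒱 H W) (hU : IsOpen U)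
    (hUc : IsCompact (closure U)) (hUW : closure U ⊆ W) {u : X → ℝ}
    (hu : LowerSemicontinuousOn u (closure U)) (hb : ∀ z ∈ frontier U, 0 ≤ u z)
    (hs : ∀ x ∈ U, ∃ V ∈ inside 𝒱 U, x ∈ V ∧ Integrable u (H V x) ∧ sweep (H V) u x ≤ u x) :
    ∀ x ∈ closure U, 0 ≤ u x := by
  intro x₀ hx₀
  obtain ⟨a, haU, ha⟩ := hu.exists_isMinOn ⟨x₀, hx₀⟩ hUc
  refine le_trans ?_ (ha hx₀)
  by_contra! hneg
  let 𝒩 : X → Set (Measure X) := fun x => {μ | ∃ V ∈ inside 𝒱 U, x ∈ V ∧ μ = H V x ∧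
    Integrable u (H V x) ∧ sweep (H V) u x ≤ u x}
  have habs : IsAbsorbing 𝒩 (closure U) := by
    rintro x - _ ⟨V, hV, hxV, rfl, -⟩
    exact ((hN.boundary V hV.1).ae_mem_frontier hxV).mono
      fun y hy => subset_closure (hV.2 (frontier_subset_closure hy))
  have hMa : IsAbsorbing 𝒩 (closure U ∩ u ⁻¹' Iic (u a)) := by
    refine habs.inter_preimage_Iic (fun y hy => ha hy) ?_ ?_ ?_
    all_goals rintro x - _ ⟨V, hV, -, rfl, hi, hle⟩
    · exact (hN.isMarkovKernel hV.1).isProbabilityMeasure x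
    · exact hi
    · exact hle
  have hM : IsCompact (closure U ∩ u ⁻¹' Iic (u a)) := by
    obtain ⟨v, hv, hvU⟩ := lowerSemicontinuousOn_iff_preimage_Iic.1 hu (u a)
    exact hvU.symm ▸ hUc.inter_right hv
  refine hW.not_isAbsorbing hN hM ⟨a, haU, le_refl (u a)⟩ (inter_subset_left.trans hUW) ?_ ?_ hMa
  · rintro x _ ⟨V, hV, hxV, rfl, -⟩
    exact ⟨V, inside_mono (subset_closure.trans hUW) hV, hxV, rfl⟩
  · rintro x ⟨hx, hxa⟩
    have hxU : x ∈ U := by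
      by_contra hxU
      exact (hxa.trans_lt hneg).not_ge (hb x (hU.frontier_eq ▸ ⟨hx, hxU⟩))
    obtain ⟨V, hV, hxV, hi, hle⟩ := hs x hxU
    exact ⟨_, V, hV, hxV, rfl, hi, hle⟩

/-- The minimum principle on `V`, applied to `s - H_V f`. -/
theorem IsLocallySuperharmonic.sweep_le (hs : IsLocallySuperharmonic 𝒱 H Ω s)
    (hN : IsNormalBauerFamily 𝒱 H) (hW : IsPSet 𝒱 H W) (hΩW : Ω ⊆ W) {f : X → ℝ}
    (hf : Continuous f) (hfb : IsBoundedBorel f) (hfs : ∀ x ∈ Ω, f x ≤ s x)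
    (hV : V ∈ inside 𝒱 Ω) {x : X} (hx : x ∈ V) : sweep (H V) f x ≤ s x := by
  have hVo := hN.isOpen hV.1
  have := hN.isMarkovKernel hV.1
  have hcont : Continuous (sweep (H V) f) := hN.feller V hV.1 f hf
  suffices h : ∀ y ∈ closure V, 0 ≤ s y - sweep (H V) f y from
    sub_nonneg.1 (h x (subset_closure hx))
  refine minimum_principle hN hW hVo (hN.compact_closure V hV.1) (hV.2.trans hΩW) ?_ ?_ ?_
  · simp only [sub_eq_add_neg]
    exact (hs.lowerSemicontinuousOn.mono hV.2).add
      (hcont.neg.lowerSemicontinuous.lowerSemicontinuousOn _)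
  · intro z hz
    have hzV : z ∉ V := (hVo.frontier_eq ▸ hz).2
    rw [(hN.boundary V hV.1).sweep_of_notMem hzV, sub_nonneg]
    exact hfs z (hV.2 (frontier_subset_closure hz))
  · intro y hy
    obtain ⟨B, hB, hyB, hBV, hle⟩ := hs.exists_sweep_le y (hV.2 (subset_closure hy)) V
      (hVo.mem_nhds hy)
    have := hN.isMarkovKernel hB
    have hcomp := hN.compatible V hV.1 B hB (subset_closure.trans hBV)
    refine ⟨B, ⟨hB, hBV⟩, hyB, (hs.isBoundedBorel.sub hfb.sweep).integrable _, ?_⟩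
    rw [sweep_sub hs.isBoundedBorel hfb.sweep, sweep_sweep hcomp hfb]
    exact sub_le_sub_right hle _

end MinimumPrinciple

end Superharmonic

section Topology

variable {X : Type*} [TopologicalSpace X]

theorem exists_boundedContinuous_eqOn [T2Space X] [NormalSpace X] {s : Set X} (hs : IsCompact s)
    {f : X → ℝ} (hf : ContinuousOn f s) : ∃ F : X →ᵇ ℝ, EqOn F f s := by
  have := isCompact_iff_compactSpace.1 hs
  obtain ⟨F, -, hF⟩ := BoundedContinuousFunction.exists_norm_eq_domRestrict_eq_of_closed
    (BoundedContinuousFunction.mkOfCompact ⟨s.domRestrict f, hf.domRestrict⟩) hs.isClosed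
  exact ⟨F, fun x hx => DFunLike.congr_fun hF ⟨x, hx⟩⟩

theorem exists_monotone_seq_tendsto_isLUB [SecondCountableTopology X] {𝓕 : Set (X → ℝ)}
    (hne : 𝓕.Nonempty) (hsup : SupClosed 𝓕) (hlsc : ∀ f ∈ 𝓕, LowerSemicontinuous f) {s : X → ℝ}
    (hs : IsLUB 𝓕 s) :
    ∃ g : ℕ → X → ℝ, (∀ n, g n ∈ 𝓕) ∧ Monotone g ∧
      ∀ x, Tendsto (fun n => g n x) atTop (𝓝 (s x)) := by
  obtain ⟨f, hf⟩ := hne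
  obtain ⟨𝓒, h𝓒, hcount, hlub⟩ := exists_countable_lowerSemicontinuous_isLUB hlsc hs
  obtain ⟨d, hd⟩ := (hcount.insert f).exists_eq_range (insert_nonempty f 𝓒)
  have hd𝓕 : ∀ n, d n ∈ 𝓕 := fun n => insert_subset hf h𝓒 (hd ▸ mem_range_self n)
  have hsd : IsLUB (range d) s := by
    rw [← hd]
    simpa [sup_eq_right.2 (hs.1 hf)] using hlub.insert f
  have hsp : IsLUB (range (partialSups d)) s := by
    rwa [IsLUB, upperBounds_range_partialSups]
  refine ⟨partialSups d, fun n => ?_, (partialSups d).monotone, fun x => ?_⟩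
  · induction n with
    | zero => simpa using hd𝓕 0
    | succ n ih => rw [partialSups_add_one]; exact hsup ih (hd𝓕 _)
  · refine tendsto_atTop_isLUB (fun m n h => (partialSups d).monotone h x) ?_
    simpa [← range_comp, Function.comp_def] using isLUB_pi.1 hsp x

end Topology

section LowerSemicontinuity

variable {X : Type*} [TopologicalSpace X] [T2Space X] [LocallyCompactSpace X]
  [SecondCountableTopology X] [MeasurableSpace X] [BorelSpace X] {𝒱 : Set (Set X)}
  {H : Set X → Kernel X X} {V : Set X}

theorem lowerSemicontinuous_sweep (hN : IsNormalBauerFamily 𝒱 H) (hV : V ∈ 𝒱) {f : X → ℝ}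
    (hf : IsBoundedBorel f) (hlsc : LowerSemicontinuous f) :
    LowerSemicontinuous (sweep (H V) f) := by
  have := hN.isMarkovKernel hV
  intro x c hc
  by_cases hxV : x ∈ V
  · exact ((hN.strong_feller V hV f hf.measurable hf.bounded).continuousAt
      ((hN.isOpen hV).mem_nhds hxV)).eventually (lt_mem_nhds hc)
  rw [(hN.boundary V hV).sweep_of_notMem hxV] at hc
  obtain ⟨d, hcd, hdf⟩ := exists_between hc
  obtain ⟨C, hC⟩ := hf.bounded
  obtain ⟨θ, hθ0, hθ1, hθ⟩ := exists_continuous_zero_one_of_isClosed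
    (hlsc.isOpen_preimage d).isClosed_compl (isClosed_singleton (x := x))
    (disjoint_singleton_right.2 fun h => h hdf)
  -- a continuous minorant of `f` which exceeds `c` at `x`
  let k : X → ℝ := fun y => -(C + |d|) + (d + (C + |d|)) * θ y
  have hk : Continuous k := by fun_prop
  have hkf : ∀ y, k y ≤ f y := by
    intro y
    have hfy := (abs_le.1 (hC y)).1
    by_cases hy : d < f y
    · have : (d + (C + |d|)) * θ y ≤ (d + (C + |d|)) * 1 :=
        mul_le_mul_of_nonneg_left (hθ y).2
          (by linarith [neg_abs_le d, (abs_nonneg _).trans (hC x)])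
      simp only [k]
      linarith
    · simp only [k, hθ0 hy, Pi.zero_apply, mul_zero, add_zero]
      linarith [abs_nonneg d]
  have hkb : IsBoundedBorel k := (IsBoundedBorel.const _).add
    (.const_mul _
      ⟨θ.continuous.measurable, 1, fun y => abs_le.2 ⟨by linarith [(hθ y).1], (hθ y).2⟩⟩)
  have hkx : c < sweep (H V) k x := by
    rw [(hN.boundary V hV).sweep_of_notMem hxV]
    simp only [k, hθ1 rfl, Pi.one_apply, mul_one]
    linarith
  filter_upwards [(hN.feller V hV k hk).continuousAt.eventually (lt_mem_nhds hkx)] with y hy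
  exact hy.trans_le (sweep_mono hkb hf hkf y)

end LowerSemicontinuity

section Harmonic

variable {X : Type*} [TopologicalSpace X] [MeasurableSpace X] {𝒱 : Set (Set X)}
  {H : Set X → Kernel X X} {U V W Ω : Set X} {g h : X → ℝ}

theorem harmonic_sweep (hN : IsNormalBauerFamily 𝒱 H) (hV : V ∈ 𝒱) {f : X → ℝ}
    (hf : IsBoundedBorel f) : Harmonic 𝒱 H V (sweep (H V) f) :=
  have := hN.isMarkovKernel hV
  ⟨hN.strong_feller V hV f hf.measurable hf.bounded, fun B hB x _ =>
    sweep_sweep (hN.compatible V hV B hB.1 (subset_closure.trans hB.2)) hf x⟩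

theorem harmonic_const (hN : IsNormalBauerFamily 𝒱 H) (c : ℝ) : Harmonic 𝒱 H U fun _ => c :=
  ⟨continuousOn_const, fun _ hV x _ => have := hN.isMarkovKernel hV.1; sweep_const c x⟩

namespace Harmonic

theorem mono (hh : Harmonic 𝒱 H Ω h) (hU : U ⊆ Ω) : Harmonic 𝒱 H U h :=
  ⟨hh.1.mono hU, fun V hV => hh.2 V (inside_mono hU hV)⟩

theorem congr (hh : Harmonic 𝒱 H U h) (hN : IsNormalBauerFamily 𝒱 H) (hgh : EqOn g h U) :
    Harmonic 𝒱 H U g := by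
  refine ⟨hh.1.congr hgh, fun V hV x hx => ?_⟩
  rw [hgh (hV.2 (subset_closure hx)), ← hh.2 V hV x hx]
  exact (hN.boundary V hV.1).sweep_congr hx (hgh.mono (frontier_subset_closure.trans hV.2))

theorem isSuperharmonic (hh : Harmonic 𝒱 H U h) (hb : IsBoundedBorel h) :
    IsSuperharmonic 𝒱 H U h :=
  ⟨hb, hh.1.lowerSemicontinuousOn, fun V hV x hx => (hh.2 V hV x hx).le⟩

variable [T2Space X] [BorelSpace X]

theorem integrable (hh : Harmonic 𝒱 H U h) (hN : IsNormalBauerFamily 𝒱 H) (hV : V ∈ inside 𝒱 U)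
    {x : X} (hx : x ∈ V) : Integrable h (H V x) :=
  have := hN.isMarkovKernel hV.1
  (hN.boundary V hV.1).integrable_of_continuousOn (hN.isCompact_frontier hV.1) hx
    (hh.1.mono (frontier_subset_closure.trans hV.2))

theorem sub (hg : Harmonic 𝒱 H U g) (hh : Harmonic 𝒱 H U h) (hN : IsNormalBauerFamily 𝒱 H) :
    Harmonic 𝒱 H U fun x => g x - h x := by
  refine ⟨hg.1.sub hh.1, fun V hV x hx => ?_⟩
  rw [integral_sub (hg.integrable hN hV hx) (hh.integrable hN hV hx), hg.2 V hV x hx,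
    hh.2 V hV x hx]

variable [LocallyCompactSpace X] [SecondCountableTopology X]

theorem nonneg (hh : Harmonic 𝒱 H U h) (hN : IsNormalBauerFamily 𝒱 H) (hW : IsPSet 𝒱 H W)
    (hU : IsOpen U) (hUc : IsCompact (closure U)) (hUW : closure U ⊆ W)
    (hc : ContinuousOn h (closure U)) (hb : ∀ z ∈ frontier U, 0 ≤ h z) :
    ∀ x ∈ closure U, 0 ≤ h x := by
  refine minimum_principle hN hW hU hUc hUW hc.lowerSemicontinuousOn hb fun x hx => ?_
  obtain ⟨V, hV, hxV, hVU⟩ := hN.exists_mem_closure_subset (hU.mem_nhds hx)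
  exact ⟨V, ⟨hV, hVU⟩, hxV, hh.integrable hN ⟨hV, hVU⟩ hxV, (hh.2 V ⟨hV, hVU⟩ x hxV).le⟩

theorem eqOn_closure (hg : Harmonic 𝒱 H U g) (hh : Harmonic 𝒱 H U h)
    (hN : IsNormalBauerFamily 𝒱 H) (hW : IsPSet 𝒱 H W) (hU : IsOpen U)
    (hUc : IsCompact (closure U)) (hUW : closure U ⊆ W) (hgc : ContinuousOn g (closure U))
    (hhc : ContinuousOn h (closure U)) (hgh : EqOn g h (frontier U)) : EqOn g h (closure U) :=
  fun x hx => le_antisymm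
    (sub_nonneg.1 ((hh.sub hg hN).nonneg hN hW hU hUc hUW (hhc.sub hgc)
      (fun _ hz => sub_nonneg.2 (hgh hz).le) x hx))
    (sub_nonneg.1 ((hg.sub hh hN).nonneg hN hW hU hUc hUW (hgc.sub hhc)
      (fun _ hz => sub_nonneg.2 (hgh hz).ge) x hx))

end Harmonic

theorem harmonic_of_tendstoUniformlyOn [T2Space X] [BorelSpace X] (hN : IsNormalBauerFamily 𝒱 H)
    {F : ℕ → X → ℝ} (hF : ∀ n, Harmonic 𝒱 H U (F n)) (hFh : TendstoUniformlyOn F h atTop U) :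
    Harmonic 𝒱 H U h := by
  have hc : ContinuousOn h U := hFh.continuousOn (.of_forall fun n => (hF n).1)
  refine ⟨hc, fun V hV x hx => ?_⟩
  have := hN.isMarkovKernel hV.1
  have hae : ∀ᵐ y ∂(H V x), y ∈ U := ((hN.boundary V hV.1).ae_mem_frontier hx).mono
    fun y hy => hV.2 (frontier_subset_closure hy)
  have hint : Integrable h (H V x) := (hN.boundary V hV.1).integrable_of_continuousOn
    (hN.isCompact_frontier hV.1) hx (hc.mono (frontier_subset_closure.trans hV.2))
  refine tendsto_nhds_unique ?_ (hFh.tendsto_at (hV.2 (subset_closure hx)))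
  rw [Metric.tendsto_atTop]
  intro ε hε
  obtain ⟨n₀, hn₀⟩ := eventually_atTop.1 (Metric.tendstoUniformlyOn_iff.1 hFh (ε / 2) (half_pos hε))
  refine ⟨n₀, fun n hn => ?_⟩
  rw [← (hF n).2 V hV x hx, Real.dist_eq, ← integral_sub ((hF n).integrable hN hV hx) hint,
    ← Real.norm_eq_abs]
  refine (norm_integral_le_of_norm_le_const (C := ε / 2) ?_).trans_lt (by simpa using hε)
  filter_upwards [hae] with y hy
  rw [Real.norm_eq_abs, ← Real.dist_eq, dist_comm]
  exact (hn₀ n hn y hy).le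

end Harmonic

section Reduced

variable {X : Type*} [TopologicalSpace X] [MeasurableSpace X] {𝒱 : Set (Set X)}
  {H : Set X → Kernel X X} {U V W Ω : Set X}

/-- The functions obtained from `φ` by finitely many applications of pointwise maxima and of the
operators `H_V`, `V ∈ 𝒱(Ω)`. -/
inductive IsIteratedSweep (𝒱 : Set (Set X)) (H : Set X → Kernel X X) (Ω : Set X) (φ : X → ℝ) :
    (X → ℝ) → Prop
  | base : IsIteratedSweep 𝒱 H Ω φ φ
  | sup {f g : X → ℝ} : IsIteratedSweep 𝒱 H Ω φ f → IsIteratedSweep 𝒱 H Ω φ g →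
      IsIteratedSweep 𝒱 H Ω φ (f ⊔ g)
  | sweep {V : Set X} {f : X → ℝ} : V ∈ inside 𝒱 Ω → IsIteratedSweep 𝒱 H Ω φ f →
      IsIteratedSweep 𝒱 H Ω φ (sweep (H V) f)

/-- The reduced function of `φ` on `Ω`, its smallest superharmonic majorant there. It is encoded as
the supremum of all iterated sweeps of `φ`, so that it equals `φ` off `Ω`. -/
noncomputable def reduced (𝒱 : Set (Set X)) (H : Set X → Kernel X X) (Ω : Set X) (φ : X → ℝ)
    (x : X) : ℝ :=
  sSup (Function.eval x '' {f | IsIteratedSweep 𝒱 H Ω φ f})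

namespace IsIteratedSweep

theorem continuous {φ f : X → ℝ} (hf : IsIteratedSweep 𝒱 H Ω φ f) (hN : IsNormalBauerFamily 𝒱 H)
    (hφ : Continuous φ) : Continuous f := by
  induction hf with
  | base => exact hφ
  | sup _ _ hf hg => exact hf.max hg
  | sweep hV _ hf => exact hN.feller _ hV.1 _ hf

theorem abs_le {φ f : X → ℝ} (hf : IsIteratedSweep 𝒱 H Ω φ f) (hN : IsNormalBauerFamily 𝒱 H)
    {C : ℝ} (hφ : ∀ x, |φ x| ≤ C) (x : X) : |f x| ≤ C := by
  induction hf generalizing x with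
  | base => exact hφ x
  | sup _ _ hf hg => exact abs_max_le_max_abs_abs.trans (max_le (hf x) (hg x))
  | sweep hV _ hf =>
    have := hN.isMarkovKernel hV.1
    exact abs_sweep_le hf x

variable [BorelSpace X]

theorem eq_of_notMem [T2Space X] {φ f : X → ℝ} (hf : IsIteratedSweep 𝒱 H Ω φ f)
    (hN : IsNormalBauerFamily 𝒱 H) {x : X} (hx : x ∉ Ω) : f x = φ x := by
  induction hf with
  | base => rfl
  | sup _ _ hf hg => simp [hf, hg]
  | sweep hV _ hf =>
    rw [(hN.boundary _ hV.1).sweep_of_notMem fun h => hx (hV.2 (subset_closure h)), hf]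

variable {φ : X →ᵇ ℝ} {f s : X → ℝ}

theorem isBoundedBorel (hf : IsIteratedSweep 𝒱 H Ω φ f) (hN : IsNormalBauerFamily 𝒱 H) :
    IsBoundedBorel f :=
  ⟨(hf.continuous hN φ.continuous).measurable, ‖φ‖, hf.abs_le hN φ.norm_coe_le_norm⟩

theorem le_of_isLocallySuperharmonic [T2Space X] [SecondCountableTopology X]
    (hf : IsIteratedSweep 𝒱 H Ω φ f) (hN : IsNormalBauerFamily 𝒱 H) (hW : IsPSet 𝒱 H W)
    (hΩW : Ω ⊆ W) (hs : IsLocallySuperharmonic 𝒱 H Ω s) (hφs : ∀ x ∈ Ω, φ x ≤ s x) :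
    ∀ x ∈ Ω, f x ≤ s x := by
  induction hf with
  | base => exact hφs
  | sup _ _ hf hg => exact fun x hx => max_le (hf x hx) (hg x hx)
  | @sweep V f hV hsweep hf =>
    intro x hx
    by_cases hxV : x ∈ V
    · exact hs.sweep_le hN hW hΩW (hsweep.continuous hN φ.continuous) (hsweep.isBoundedBorel hN) hf
        hV hxV
    · exact ((hN.boundary V hV.1).sweep_of_notMem hxV f).trans_le (hf x hx)

end IsIteratedSweep

variable {φ : X →ᵇ ℝ} {s : X → ℝ}

theorem isLUB_reduced (hN : IsNormalBauerFamily 𝒱 H) (φ : X →ᵇ ℝ) :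
    IsLUB {f | IsIteratedSweep 𝒱 H Ω φ f} (reduced 𝒱 H Ω φ) := by
  refine isLUB_pi.2 fun x => isLUB_csSup (.image _ ⟨φ, .base⟩) ⟨‖φ‖, ?_⟩
  rintro _ ⟨f, hf, rfl⟩
  exact (le_abs_self _).trans (hf.abs_le hN φ.norm_coe_le_norm x)

theorem le_reduced (hN : IsNormalBauerFamily 𝒱 H) (φ : X →ᵇ ℝ) (x : X) :
    φ x ≤ reduced 𝒱 H Ω φ x := (isLUB_reduced hN φ).1 IsIteratedSweep.base x

theorem reduced_le_of_forall {x : X} {C : ℝ} (h : ∀ f, IsIteratedSweep 𝒱 H Ω φ f → f x ≤ C) :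
    reduced 𝒱 H Ω φ x ≤ C :=
  csSup_le (.image _ ⟨φ, .base⟩) (forall_mem_image.2 h)

theorem reduced_le_norm (hN : IsNormalBauerFamily 𝒱 H) (φ : X →ᵇ ℝ) (x : X) :
    reduced 𝒱 H Ω φ x ≤ ‖φ‖ :=
  reduced_le_of_forall fun _ hf => (le_abs_self _).trans (hf.abs_le hN φ.norm_coe_le_norm x)

theorem abs_reduced_le (hN : IsNormalBauerFamily 𝒱 H) (φ : X →ᵇ ℝ) (x : X) :
    |reduced 𝒱 H Ω φ x| ≤ ‖φ‖ :=
  abs_le.2 ⟨(abs_le.1 (φ.norm_coe_le_norm x)).1.trans (le_reduced hN φ x), reduced_le_norm hN φ x⟩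

theorem lowerSemicontinuous_reduced (hN : IsNormalBauerFamily 𝒱 H) (φ : X →ᵇ ℝ) :
    LowerSemicontinuous (reduced 𝒱 H Ω φ) := by
  intro x c hc
  obtain ⟨_, ⟨f, hf, rfl⟩, hcf⟩ :=
    (lt_isLUB_iff (isLUB_pi.1 (isLUB_reduced hN φ) x)).1 hc
  filter_upwards [(hf.continuous hN φ.continuous).continuousAt.eventually (lt_mem_nhds hcf)]
    with y hy
  exact hy.trans_le ((isLUB_reduced hN φ).1 hf y)

variable [BorelSpace X]

theorem isBoundedBorel_reduced (hN : IsNormalBauerFamily 𝒱 H) (φ : X →ᵇ ℝ) :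
    IsBoundedBorel (reduced 𝒱 H Ω φ) :=
  ⟨(lowerSemicontinuous_reduced hN φ).measurable, ‖φ‖, abs_reduced_le hN φ⟩

theorem isSuperharmonic_reduced [SecondCountableTopology X] (hN : IsNormalBauerFamily 𝒱 H)
    (φ : X →ᵇ ℝ) : IsSuperharmonic 𝒱 H Ω (reduced 𝒱 H Ω φ) := by
  refine ⟨isBoundedBorel_reduced hN φ, (lowerSemicontinuous_reduced hN φ).lowerSemicontinuousOn _,
    fun V hV x _ => ?_⟩
  have := hN.isMarkovKernel hV.1
  obtain ⟨g, hg, -, hlim⟩ := exists_monotone_seq_tendsto_isLUB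
    ⟨φ, IsIteratedSweep.base⟩ (fun _ hf _ hg => IsIteratedSweep.sup hf hg)
    (fun f hf => (hf.continuous hN φ.continuous).lowerSemicontinuous) (isLUB_reduced hN φ)
  exact le_of_tendsto' (tendsto_sweep (fun n => ((hg n).isBoundedBorel hN).measurable)
    (fun n => (hg n).abs_le hN φ.norm_coe_le_norm) hlim x)
    fun n => (isLUB_reduced hN φ).1 (.sweep hV (hg n)) x

variable [T2Space X]

theorem reduced_eq_of_notMem (hN : IsNormalBauerFamily 𝒱 H) (φ : X →ᵇ ℝ) {x : X} (hx : x ∉ Ω) :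
    reduced 𝒱 H Ω φ x = φ x :=
  le_antisymm (reduced_le_of_forall fun _ hf => (hf.eq_of_notMem hN hx).le) (le_reduced hN φ x)

theorem reduced_le_of_isLocallySuperharmonic [SecondCountableTopology X]
    (hN : IsNormalBauerFamily 𝒱 H) (hW : IsPSet 𝒱 H W) (hΩW : Ω ⊆ W)
    (hs : IsLocallySuperharmonic 𝒱 H Ω s) (hφs : ∀ x ∈ Ω, φ x ≤ s x) {x : X} (hx : x ∈ Ω) :
    reduced 𝒱 H Ω φ x ≤ s x :=
  reduced_le_of_forall fun _ hf => hf.le_of_isLocallySuperharmonic hN hW hΩW hs hφs x hx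

variable [LocallyCompactSpace X] [SecondCountableTopology X]

/-- For the reduced function `R` of `φ`, the minimum of `R` and `H_V R + δ` is again a superharmonic
majorant of `φ`. -/
theorem reduced_le_sweep_reduced_add (hN : IsNormalBauerFamily 𝒱 H) (hW : IsPSet 𝒱 H W)
    (hΩ : IsOpen Ω) (hΩW : Ω ⊆ W) (hV : V ∈ inside 𝒱 Ω) {δ : ℝ} (hδ : 0 ≤ δ)
    (h : ∀ x ∈ V, φ x ≤ sweep (H V) (reduced 𝒱 H Ω φ) x + δ) {x : X} (hx : x ∈ V) :
    reduced 𝒱 H Ω φ x ≤ sweep (H V) (reduced 𝒱 H Ω φ) x + δ := by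
  have := hN.isMarkovKernel hV.1
  have hR := isBoundedBorel_reduced (Ω := Ω) hN φ
  have hoff : ∀ y ∉ V, reduced 𝒱 H Ω φ y ≤ sweep (H V) (reduced 𝒱 H Ω φ) y + δ := fun y hy => by
    rw [(hN.boundary V hV.1).sweep_of_notMem hy]
    exact le_add_of_nonneg_right hδ
  have ht : IsSuperharmonic 𝒱 H V fun y => sweep (H V) (reduced 𝒱 H Ω φ) y + δ :=
    ((harmonic_sweep hN hV.1 hR).isSuperharmonic hR.sweep).add (isSuperharmonic_const hN δ) hN
  have hlsc : LowerSemicontinuous fun y => sweep (H V) (reduced 𝒱 H Ω φ) y + δ :=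
    (lowerSemicontinuous_sweep hN hV.1 hR (lowerSemicontinuous_reduced hN φ)).add
      lowerSemicontinuous_const
  refine (reduced_le_of_isLocallySuperharmonic hN hW hΩW
    ((isSuperharmonic_reduced hN φ).isLocallySuperharmonic_min (ht.mono inter_subset_right) hN hΩ
      (hN.isOpen hV.1) (hlsc.lowerSemicontinuousOn Ω) fun y hy => hoff y hy.2)
    (fun y _ => le_min (le_reduced hN φ y) ?_) (hV.2 (subset_closure hx))).trans (min_le_right _ _)
  by_cases hyV : y ∈ V
  · exact h y hyV
  · exact (le_reduced hN φ y).trans (hoff y hyV)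

/-- On a set `V` where `φ` oscillates little, the reduced function `R` is uniformly close to the
continuous function `H_V R`. -/
theorem continuousOn_reduced (hN : IsNormalBauerFamily 𝒱 H) (hW : IsPSet 𝒱 H W) (hΩ : IsOpen Ω)
    (hΩW : Ω ⊆ W) (φ : X →ᵇ ℝ) : ContinuousOn (reduced 𝒱 H Ω φ) Ω := by
  intro x hx
  refine ContinuousAt.continuousWithinAt (Metric.continuousAt_iff'.2 fun ε hε => ?_)
  obtain ⟨V, hV, hxV, hcl⟩ := hN.exists_mem_closure_subset (inter_mem (hΩ.mem_nhds hx)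
    (φ.continuous.continuousAt.preimage_mem_nhds
      (Metric.ball_mem_nhds (φ x) (by positivity : 0 < ε / 8))))
  have hVΩ : V ∈ inside 𝒱 Ω := ⟨hV, hcl.trans inter_subset_left⟩
  have := hN.isMarkovKernel hV
  have hR := isBoundedBorel_reduced (Ω := Ω) hN φ
  have hosc : ∀ y ∈ closure V, |φ y - φ x| < ε / 8 := fun y hy => by
    simpa [Real.dist_eq] using (hcl hy).2
  have hle : ∀ y ∈ V, reduced 𝒱 H Ω φ y ≤ sweep (H V) (reduced 𝒱 H Ω φ) y + ε / 4 := by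
    refine fun y hy => reduced_le_sweep_reduced_add hN hW hΩ hΩW hVΩ (by positivity)
      (fun z hz => ?_) hy
    have hmin := (hN.boundary V hV).sweep_le_sweep hz (.const (φ x - ε / 8)) hR fun t ht => by
      linarith [abs_lt.1 (hosc t (frontier_subset_closure ht)), le_reduced (Ω := Ω) hN φ t]
    rw [sweep_const] at hmin
    linarith [abs_lt.1 (hosc z (subset_closure hz))]
  have hcont : ContinuousAt (sweep (H V) (reduced 𝒱 H Ω φ)) x :=
    (harmonic_sweep hN hV hR).1.continuousAt ((hN.isOpen hV).mem_nhds hxV)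
  have hge := (isSuperharmonic_reduced (Ω := Ω) hN φ).sweep_le V hVΩ
  filter_upwards [(hN.isOpen hV).mem_nhds hxV,
    Metric.continuousAt_iff'.1 hcont (ε / 4) (by positivity)] with y hy hyx
  rw [Real.dist_eq, abs_lt] at hyx ⊢
  constructor <;> linarith [hle x hxV, hle y hy, hge x hxV, hge y hy]

theorem harmonic_reduced (hN : IsNormalBauerFamily 𝒱 H) (hW : IsPSet 𝒱 H W) (hΩ : IsOpen Ω)
    (hΩW : Ω ⊆ W) (hUΩ : U ⊆ Ω)
    (h : ∀ V ∈ inside 𝒱 U, ∀ x ∈ V, φ x ≤ sweep (H V) (reduced 𝒱 H Ω φ) x) :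
    Harmonic 𝒱 H U (reduced 𝒱 H Ω φ) := by
  refine ⟨(continuousOn_reduced hN hW hΩ hΩW φ).mono hUΩ, fun V hV x hx => ?_⟩
  have hVΩ := inside_mono hUΩ hV
  refine le_antisymm ((isSuperharmonic_reduced hN φ).sweep_le V hVΩ x hx) ?_
  exact (reduced_le_sweep_reduced_add hN hW hΩ hΩW hVΩ le_rfl (by simpa using h V hV) hx).trans_eq
    (add_zero _)

end Reduced

section RelClopen

variable {X : Type*} [TopologicalSpace X] {A O Q : Set X}

theorem inter_frontier_nonempty_of_isPreconnected {s t : Set X} (hs : IsPreconnected s)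
    (hst : (s ∩ t).Nonempty) (hst' : (s \ t).Nonempty) : (s ∩ frontier t).Nonempty := by
  by_contra hne
  have hcov : s ⊆ interior t ∪ (closure t)ᶜ := fun z hz => by
    by_contra! h
    exact hne ⟨z, hz, of_not_not fun hc => h (.inr hc), fun hi => h (.inl hi)⟩
  obtain ⟨z, -, hzi, hzc⟩ := hs (interior t) (closure t)ᶜ isOpen_interior
    isClosed_closure.isOpen_compl hcov
    (hst.mono fun x hx => ⟨hx.1, (hcov hx.1).resolve_right fun h => h (subset_closure hx.2)⟩)
    (hst'.mono fun y hy => ⟨hy.1, (hcov hy.1).resolve_left fun h => hy.2 (interior_subset h)⟩)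
  exact hzc (interior_subset_closure hzi)

/-- `A` is a clopen subset of the subspace `O`, where `O` is open. -/
structure IsRelClopen (O A : Set X) : Prop where
  subset : A ⊆ O
  isOpen : IsOpen A
  isOpen_diff : IsOpen (O \ A)

namespace IsRelClopen

theorem diff (hA : IsRelClopen O A) : IsRelClopen O (O \ A) :=
  ⟨sdiff_subset, hA.isOpen_diff, by rw [sdiff_sdiff_cancel_left hA.subset]; exact hA.isOpen⟩

theorem mem_of_mem_closure (hA : IsRelClopen O A) {x : X} (hx : x ∈ O) (hxA : x ∈ closure A) :
    x ∈ A := by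
  by_contra h
  obtain ⟨y, hy, hyA⟩ := mem_closure_iff.1 hxA _ hA.isOpen_diff ⟨hx, h⟩
  exact hy.2 hyA

theorem isClosed_inter (hA : IsRelClopen O A) {F : Set X} (hF : IsClosed F) (hFO : F ⊆ O) :
    IsClosed (F ∩ A) :=
  isClosed_of_closure_subset fun x hx =>
    have hxF : x ∈ F := hF.closure_subset (closure_mono inter_subset_left hx)
    ⟨hxF, hA.mem_of_mem_closure (hFO hxF) (closure_mono inter_subset_right hx)⟩

theorem inter_of_disjoint {u v : Set X} (hQ : IsRelClopen O Q) (hu : IsOpen u) (hv : IsOpen v)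
    (huv : Q ⊆ u ∪ v) (hd : Q ∩ (u ∩ v) = ∅) : IsRelClopen O (Q ∩ u) := by
  refine ⟨inter_subset_left.trans hQ.subset, hQ.isOpen.inter hu, ?_⟩
  have : O \ (Q ∩ u) = (O \ Q) ∪ (Q ∩ v) := by
    ext y
    have h₁ := @huv y
    have h₂ : ¬ y ∈ Q ∩ (u ∩ v) := by simp [hd]
    have h₃ := @hQ.subset y
    simp only [Set.mem_sdiff, mem_inter_iff, mem_union] at *
    tauto
  rw [this]
  exact hQ.isOpen_diff.union (hQ.isOpen.inter hv)

/-- If quasi-components are open, then they are connected. -/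
theorem exists_isConnected (hO : IsOpen O)
    (h : ∀ 𝒜 : Set (Set X), 𝒜.Nonempty → (∀ A ∈ 𝒜, IsRelClopen O A) → IsRelClopen O (⋂₀ 𝒜)) {x : X}
    (hx : x ∈ O) : ∃ Q, IsRelClopen O Q ∧ IsConnected Q ∧ x ∈ Q := by
  have hQ : IsRelClopen O (⋂₀ {A | IsRelClopen O A ∧ x ∈ A}) :=
    h _ ⟨O, ⟨subset_rfl, hO, by simp⟩, hx⟩ fun A hA => hA.1
  have hxQ : x ∈ ⋂₀ {A | IsRelClopen O A ∧ x ∈ A} := fun A hA => hA.2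
  have hmin : ∀ B, IsRelClopen O B → x ∈ B → ⋂₀ {A | IsRelClopen O A ∧ x ∈ A} ⊆ B :=
    fun B hB hxB => sInter_subset_of_mem ⟨hB, hxB⟩
  refine ⟨_, hQ, ⟨⟨x, hxQ⟩, isPreconnected_iff_subset_of_disjoint.2 fun u v hu hv huv hd => ?_⟩,
    hxQ⟩
  rcases huv hxQ with hxu | hxv
  · exact .inl ((hmin _ (hQ.inter_of_disjoint hu hv huv hd) ⟨hxQ, hxu⟩).trans inter_subset_right)
  · rw [union_comm] at huv
    rw [inter_comm u] at hd
    exact .inr ((hmin _ (hQ.inter_of_disjoint hv hu huv hd) ⟨hxQ, hxv⟩).trans inter_subset_right)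

end IsRelClopen

end RelClopen

section Components

variable {X : Type*} [TopologicalSpace X] [T2Space X] [LocallyCompactSpace X]
  [SecondCountableTopology X] [MeasurableSpace X] [BorelSpace X] {𝒱 : Set (Set X)}
  {H : Set X → Kernel X X} {A D O V W : Set X}

/-- For continuous `f` with `f = 1_A` on the closure of `V`, the functions `H_V f` and `1` are
harmonic on `V ∩ A` with the same boundary values. -/
theorem IsRelClopen.ae_mem (hA : IsRelClopen O A) (hN : IsNormalBauerFamily 𝒱 H)
    (hW : IsPSet 𝒱 H W) (hOW : O ⊆ W) (hV : V ∈ inside 𝒱 O) {x : X} (hxV : x ∈ V) (hxA : x ∈ A) :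
    ∀ᵐ y ∂(H V x), y ∈ A := by
  have := hN.isMarkovKernel hV.1
  have hVo := hN.isOpen hV.1
  have hVA : IsClosed (closure V ∩ A) := hA.isClosed_inter isClosed_closure hV.2
  obtain ⟨f, hf0, hf1, hf⟩ := exists_continuous_zero_one_of_isClosed
    (isClosed_closure.inter hA.isOpen.isClosed_compl) hVA
    (disjoint_left.2 fun y hy hy' => hy.2 hy'.2)
  have hfb : IsBoundedBorel f :=
    ⟨f.continuous.measurable, 1, fun y => abs_le.2 ⟨by linarith [(hf y).1], (hf y).2⟩⟩
  have hcl : closure (V ∩ A) ⊆ closure V ∩ A :=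
    closure_minimal (inter_subset_inter_left A subset_closure) hVA
  have hone : EqOn (sweep (H V) f) (fun _ => 1) (closure (V ∩ A)) := by
    refine ((harmonic_sweep hN hV.1 hfb).mono inter_subset_left).eqOn_closure
      (harmonic_const hN 1) hN hW (hVo.inter hA.isOpen)
      ((hN.compact_closure V hV.1).of_isClosed_subset isClosed_closure
        (hcl.trans inter_subset_left))
      ((hcl.trans inter_subset_left).trans (hV.2.trans hOW))
      (hN.feller V hV.1 f f.continuous).continuousOn continuousOn_const fun z hz => ?_
    obtain ⟨hzcl, hzVA⟩ := (hVo.inter hA.isOpen).frontier_eq ▸ hz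
    have hzV : z ∉ V := fun h => hzVA ⟨h, (hcl hzcl).2⟩
    exact ((hN.boundary V hV.1).sweep_of_notMem hzV f).trans (hf1 (hcl hzcl))
  have hprob : H V x A = 1 := by
    have hfA : EqOn f (A.indicator 1) (frontier V) := fun y hy => by
      by_cases hyA : y ∈ A
      · simpa [hyA] using hf1 ⟨frontier_subset_closure hy, hyA⟩
      · simpa [hyA] using hf0 ⟨frontier_subset_closure hy, hyA⟩
    have h1 := hone (subset_closure ⟨hxV, hxA⟩)
    rw [(hN.boundary V hV.1).sweep_congr hxV hfA, sweep,
      integral_indicator_one hA.isOpen.measurableSet] at h1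
    rwa [measureReal_def, ENNReal.toReal_eq_one_iff] at h1
  exact (prob_compl_eq_zero_iff hA.isOpen.measurableSet).2 hprob

theorem ae_mem_sInter_of_isRelClopen (hN : IsNormalBauerFamily 𝒱 H) (hW : IsPSet 𝒱 H W)
    (hOW : O ⊆ W) {𝒜 : Set (Set X)} (h𝒜 : ∀ A ∈ 𝒜, IsRelClopen O A) (hV : V ∈ inside 𝒱 O) {x : X}
    (hxV : x ∈ V) (hx : x ∈ ⋂₀ 𝒜) : ∀ᵐ y ∂(H V x), y ∈ ⋂₀ 𝒜 := by
  have habs : IsAbsorbing (fun x => {μ | x ∈ V ∧ μ = H V x}) (⋂₀ ((closure V ∩ ·) '' 𝒜)) := by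
    refine IsAbsorbing.sInter (forall_mem_image.2 fun A hA =>
      (h𝒜 A hA).isClosed_inter isClosed_closure hV.2) (forall_mem_image.2 fun A hA => ?_)
    rintro y hy _ ⟨hyV, rfl⟩
    filter_upwards [(hN.boundary V hV.1).ae_mem_frontier hyV,
      (h𝒜 A hA).ae_mem hN hW hOW hV hyV hy.2] with z hzV hzA
    exact ⟨frontier_subset_closure hzV, hzA⟩
  refine (habs x (forall_mem_image.2 fun A hA => ⟨subset_closure hxV, hx A hA⟩) _
    ⟨hxV, rfl⟩).mono fun y hy A hA => (hy _ (mem_image_of_mem _ hA)).2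

/-- On `V ∈ 𝒱(O)`, the indicator function of the intersection coincides with its continuous
sweep. -/
theorem IsRelClopen.sInter (hN : IsNormalBauerFamily 𝒱 H) (hW : IsPSet 𝒱 H W) (hO : IsOpen O)
    (hOW : O ⊆ W) {𝒜 : Set (Set X)} (hne : 𝒜.Nonempty) (h𝒜 : ∀ A ∈ 𝒜, IsRelClopen O A) :
    IsRelClopen O (⋂₀ 𝒜) := by
  set Q := ⋂₀ 𝒜 with hQ
  have hQO : Q ⊆ O := hne.elim fun A hA => (sInter_subset_of_mem hA).trans (h𝒜 A hA).subset
  have hOQ : IsOpen (O \ Q) := by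
    have : O \ Q = ⋃ A ∈ 𝒜, O \ A := by ext; simp [hQ]
    rw [this]
    exact isOpen_biUnion fun A hA => (h𝒜 A hA).isOpen_diff
  have hQm : MeasurableSet Q := by
    rw [← sdiff_sdiff_cancel_left hQO]
    exact hO.measurableSet.diff hOQ.measurableSet
  refine ⟨hQO, isOpen_iff_mem_nhds.2 fun x hx => ?_, hOQ⟩
  obtain ⟨V, hV, hxV, hVO⟩ := hN.exists_mem_closure_subset (hO.mem_nhds (hQO hx))
  have := hN.isMarkovKernel hV
  have hone : sweep (H V) (Q.indicator fun _ => 1) x = 1 := by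
    rw [sweep, integral_congr_ae (g := fun _ => 1)]
    · simp
    filter_upwards [ae_mem_sInter_of_isRelClopen hN hW hOW h𝒜 ⟨hV, hVO⟩ hxV hx] with y hy
    exact indicator_of_mem hy _
  have hzero : ∀ y ∈ V \ Q, sweep (H V) (Q.indicator fun _ => 1) y = 0 := by
    rintro y ⟨hyV, hyQ⟩
    obtain ⟨A, hA, hyA⟩ : ∃ A ∈ 𝒜, y ∉ A := by simpa [hQ] using hyQ
    rw [sweep, integral_congr_ae (g := fun _ => 0)]
    · simp
    filter_upwards [(h𝒜 A hA).diff.ae_mem hN hW hOW ⟨hV, hVO⟩ hyV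
      ⟨hVO (subset_closure hyV), hyA⟩] with z hz
    exact indicator_of_notMem (fun hzQ : z ∈ Q => hz.2 (hzQ A hA)) _
  have hcont := (harmonic_sweep hN hV (isBoundedBorel_indicator hQm 1)).1.continuousAt
    ((hN.isOpen hV).mem_nhds hxV)
  filter_upwards [(hN.isOpen hV).mem_nhds hxV,
    hcont.eventually (lt_mem_nhds (hone.symm ▸ one_pos))] with y hyV hy
  by_contra hyQ
  exact hy.ne' (hzero y ⟨hyV, hyQ⟩)

theorem exists_isRelClopen_isConnected (hN : IsNormalBauerFamily 𝒱 H) (hW : IsPSet 𝒱 H W)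
    (hO : IsOpen O) (hOW : O ⊆ W) {x : X} (hx : x ∈ O) :
    ∃ Q, IsRelClopen O Q ∧ IsConnected Q ∧ x ∈ Q :=
  IsRelClopen.exists_isConnected hO (fun _ => IsRelClopen.sInter hN hW hO hOW) hx

variable {q : X → ℝ}

/-- On the component `Q` of `x` in `V`, the positive harmonic function `H_V q` vanishes by
ellipticity, and it equals `q` on the boundary. -/
theorem IsSuperharmonic.exists_eqOn_zero_frontier (hq : IsSuperharmonic 𝒱 H D q)
    (hell : IsElliptic 𝒱 H) (hN : IsNormalBauerFamily 𝒱 H) (hW : IsPSet 𝒱 H W) (hDW : D ⊆ W)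
    (hqc : ContinuousOn q D) (hq0 : ∀ y ∈ D, 0 ≤ q y) (hV : V ∈ inside 𝒱 D) {x : X} (hx : x ∈ V)
    (hqx : q x = 0) : ∃ Q, IsOpen Q ∧ x ∈ Q ∧ Q ⊆ V ∧ EqOn q 0 (frontier Q) := by
  have := hN.isMarkovKernel hV.1
  have hVo := hN.isOpen hV.1
  obtain ⟨Q, hQ, hQc, hxQ⟩ := exists_isRelClopen_isConnected hN hW hVo
    (subset_closure.trans (hV.2.trans hDW)) hx
  refine ⟨Q, hQ.isOpen, hxQ, hQ.subset, fun z hz => ?_⟩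
  obtain ⟨F, hFq⟩ := exists_boundedContinuous_eqOn (hN.compact_closure V hV.1) (hqc.mono hV.2)
  have hFb := IsBoundedBorel.of_boundedContinuous F
  have hnonneg : ∀ y ∈ V, 0 ≤ sweep (H V) F y := fun y hy => by
    have := (hN.boundary V hV.1).sweep_le_sweep hy (.const 0) hFb fun t ht =>
      (hq0 t (hV.2 (frontier_subset_closure ht))).trans_eq (hFq (frontier_subset_closure ht)).symm
    rwa [sweep_const] at this
  have hsx : sweep (H V) F x ≤ 0 := by
    rw [(hN.boundary V hV.1).sweep_congr hx (hFq.mono frontier_subset_closure), ← hqx]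
    exact hq.sweep_le V hV x hx
  have hzero : ∀ y ∈ Q, sweep (H V) F y = 0 :=
    (hell Q hQ.isOpen hQc _ ((harmonic_sweep hN hV.1 hFb).mono hQ.subset)
      fun y hy => hnonneg y (hQ.subset hy)).resolve_right fun h => hsx.not_gt (h x hxQ)
  have hzcl := frontier_subset_closure hz
  have hzV : z ∉ V := fun h => (hQ.isOpen.frontier_eq ▸ hz).2 (hQ.mem_of_mem_closure h hzcl)
  rw [← hFq (closure_mono hQ.subset hzcl), ← (hN.boundary V hV.1).sweep_of_notMem hzV F]
  exact closure_minimal hzero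
    (isClosed_eq (hN.feller V hV.1 F F.continuous) continuous_const) hzcl

/-- The strict minimum principle. A component `G` of `{q > 0}` with a boundary point `x ∈ D` would
meet the boundary of a small neighborhood `Q` of `x` on which `q = 0`. -/
theorem IsSuperharmonic.eq_zero_or_pos (hq : IsSuperharmonic 𝒱 H D q) (hell : IsElliptic 𝒱 H)
    (hN : IsNormalBauerFamily 𝒱 H) (hW : IsPSet 𝒱 H W) (hD : IsOpen D) (hDc : IsConnected D)
    (hDW : D ⊆ W) (hqc : ContinuousOn q D) (hq0 : ∀ x ∈ D, 0 ≤ q x) :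
    (∀ x ∈ D, q x = 0) ∨ ∀ x ∈ D, 0 < q x := by
  by_contra! hcon
  obtain ⟨⟨y, hyD, hy⟩, ⟨x₀, hx₀D, hx₀⟩⟩ := hcon
  have hP : IsOpen (D ∩ q ⁻¹' Ioi 0) := hqc.isOpen_inter_preimage hD isOpen_Ioi
  obtain ⟨G, hG, hGc, hyG⟩ := exists_isRelClopen_isConnected hN hW hP
    (inter_subset_left.trans hDW) ⟨hyD, (hq0 y hyD).lt_of_ne' hy⟩
  obtain ⟨x, hxD, hxG⟩ := inter_frontier_nonempty_of_isPreconnected hDc.isPreconnected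
    ⟨y, hyD, hyG⟩ ⟨x₀, hx₀D, fun h => hx₀.not_gt (hG.subset h).2⟩
  have hxcl : x ∈ closure G := frontier_subset_closure hxG
  have hxG' : x ∉ G := (hG.isOpen.frontier_eq ▸ hxG).2
  have hqx : q x = 0 := by
    by_contra hne
    exact hxG' (hG.mem_of_mem_closure ⟨hxD, (hq0 x hxD).lt_of_ne' hne⟩ hxcl)
  obtain ⟨V, hV, hxV, hVD⟩ := hN.exists_mem_closure_subset
    ((hD.sdiff isClosed_singleton).mem_nhds (⟨hxD, fun h => hxG' (h ▸ hyG)⟩ : x ∈ D \ {y}))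
  obtain ⟨Q, hQ, hxQ, hQV, hQ0⟩ := hq.exists_eqOn_zero_frontier hell hN hW hDW hqc hq0
    ⟨hV, hVD.trans sdiff_subset⟩ hxV hqx
  obtain ⟨z, hzQ, hzG⟩ := mem_closure_iff.1 hxcl Q hQ hxQ
  obtain ⟨w, hwG, hwQ⟩ := inter_frontier_nonempty_of_isPreconnected hGc.isPreconnected
    ⟨z, hzG, hzQ⟩ ⟨y, hyG, fun h => (hVD (subset_closure (hQV h))).2 rfl⟩
  exact (hG.subset hwG).2.ne' (hQ0 hwQ)

end Components

section Barriers

variable {X : Type*} [TopologicalSpace X] {G : Set X}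

theorem frontier_diff_biUnion_subset {ι : Type*} {T : Finset ι} {B : ι → Set X} (hG : IsOpen G)
    (hB : ∀ i ∈ T, IsClosed (B i)) (hGB : frontier G ⊆ ⋃ i ∈ T, interior (B i)) :
    frontier (G \ ⋃ i ∈ T, B i) ⊆ ⋃ i ∈ T, frontier (B i) := by
  intro y hy
  have hU : IsOpen (G \ ⋃ i ∈ T, B i) := hG.sdiff (T.finite_toSet.isClosed_biUnion hB)
  have hycl := frontier_subset_closure hy
  have hyint : ∀ i ∈ T, y ∉ interior (B i) := fun i hi hyi => by
    obtain ⟨x, hxi, hx⟩ := mem_closure_iff.1 hycl _ isOpen_interior hyi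
    exact hx.2 (mem_biUnion hi (interior_subset hxi))
  have hyG : y ∈ G := by
    by_contra hyG
    have hyfr : y ∈ frontier G := hG.frontier_eq ▸ ⟨closure_mono sdiff_subset hycl, hyG⟩
    obtain ⟨i, hi, hyi⟩ := mem_iUnion₂.1 (hGB hyfr)
    exact hyint i hi hyi
  obtain ⟨i, hi, hyi⟩ : ∃ i ∈ T, y ∈ B i := by
    by_contra! h
    exact (hU.frontier_eq ▸ hy).2 ⟨hyG, by simpa only [mem_iUnion₂, not_exists] using h⟩
  exact mem_biUnion hi ((hB i hi).frontier_eq ▸ ⟨hyi, hyint i hi⟩)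

variable [MeasurableSpace X] {𝒱 : Set (Set X)} {H : Set X → Kernel X X}
  {C D K N U V W : Set X} {x y z : X} {φ : X →ᵇ ℝ} {s h : X → ℝ}

/-- A barrier for `U` at `z` is a harmonic function near `z` which vanishes at `z` and is strictly
positive on `U`. Here `z` is thought of as a boundary point of `U`. -/
def HasBarrierAt (𝒱 : Set (Set X)) (H : Set X → Kernel X X) (U : Set X) (z : X) : Prop :=
  ∃ (N : Set X) (h : X → ℝ), IsOpen N ∧ z ∈ N ∧ Harmonic 𝒱 H N h ∧ h z = 0 ∧ ∀ x ∈ U ∩ N, 0 < h x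

theorem HasBarrierAt.mono (hz : HasBarrierAt 𝒱 H U z) (hVU : V ⊆ U) : HasBarrierAt 𝒱 H V z := by
  obtain ⟨N, h, hN, hzN, hh, hhz, hpos⟩ := hz
  exact ⟨N, h, hN, hzN, hh, hhz, fun x hx => hpos x ⟨hVU hx.1, hx.2⟩⟩

theorem IsSuperharmonic.sub_harmonic (hs : IsSuperharmonic 𝒱 H U s) (hh : Harmonic 𝒱 H U h)
    (hN : IsNormalBauerFamily 𝒱 H) (hb : IsBoundedBorel h) :
    IsSuperharmonic 𝒱 H U fun x => s x - h x := by
  refine ⟨hs.isBoundedBorel.sub hb, ?_, fun V hV x hx => ?_⟩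
  · simp only [sub_eq_add_neg]
    exact hs.lowerSemicontinuousOn.add hh.1.neg.lowerSemicontinuousOn
  · have := hN.isMarkovKernel hV.1
    rw [sweep_sub hs.isBoundedBorel hb]
    exact sub_le_sub (hs.sweep_le V hV x hx) (hh.2 V hV x hx).ge

variable [T2Space X] [LocallyCompactSpace X] [BorelSpace X]

theorem IsPSet.exists_isSuperharmonic_lt (hW : IsPSet 𝒱 H W) (hN : IsNormalBauerFamily 𝒱 H)
    (hD : IsOpen D) (hDne : D.Nonempty) (hDW : D ⊆ W) : ∃ s, IsSuperharmonic 𝒱 H W s ∧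
      (∀ z, 0 ≤ s z) ∧ ∃ x ∈ D, ∃ y ∈ D, s y < s x := by
  obtain ⟨x, hx⟩ := hDne
  obtain ⟨V, hV, hxV, hVD⟩ := hN.exists_mem_closure_subset (hD.mem_nhds hx)
  obtain ⟨y, hy⟩ := hN.frontier_nonempty hV hxV
  have hyD : y ∈ D := hVD (frontier_subset_closure hy)
  have hxy : x ≠ y := by
    rintro rfl
    exact ((hN.isOpen hV).frontier_eq ▸ hy).2 hxV
  obtain ⟨s, hs, hs0, hne⟩ := hW.exists_isSuperharmonic_ne hN (hDW hx) (hDW hyD) hxy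
  rcases lt_or_gt_of_ne hne with h | h
  · exact ⟨s, hs, hs0, y, hyD, x, hx, h⟩
  · exact ⟨s, hs, hs0, x, hx, y, hyD, h⟩

variable [SecondCountableTopology X]

theorem continuousOn_sweep_closure (hN : IsNormalBauerFamily 𝒱 H) (hV : V ∈ 𝒱) {f : X → ℝ}
    (hf : ContinuousOn f (closure V)) : ContinuousOn (sweep (H V) f) (closure V) := by
  obtain ⟨F, hF⟩ := exists_boundedContinuous_eqOn (hN.compact_closure V hV) hf
  refine (hN.feller V hV F F.continuous).continuousOn.congr fun x hx => ?_
  by_cases hxV : x ∈ V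
  · exact (hN.boundary V hV).sweep_congr hxV (hF.mono frontier_subset_closure).symm
  · change _ = sweep (H V) F x
    rw [(hN.boundary V hV).sweep_of_notMem hxV, (hN.boundary V hV).sweep_of_notMem hxV, hF hx]

/-- With `s y < t < s x`, take for `φ` a bump function of height `t = φ x` below `s`. -/
theorem IsSuperharmonic.exists_reduced_lt (hs : IsSuperharmonic 𝒱 H W s)
    (hN : IsNormalBauerFamily 𝒱 H) (hW : IsPSet 𝒱 H W) (hs0 : ∀ z, 0 ≤ s z) (hx : x ∈ W)
    (hy : y ∈ W) (hxy : s y < s x) (hNx : N ∈ 𝓝 x) :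
    ∃ (φ : X →ᵇ ℝ) (C : Set X), IsCompact C ∧ C ⊆ N ∧ (∀ z, 0 ≤ φ z) ∧ EqOn φ 0 Cᶜ ∧
      reduced 𝒱 H W φ y < ‖φ‖ ∧ reduced 𝒱 H W φ x = ‖φ‖ := by
  obtain ⟨t, hyt, htx⟩ := exists_between hxy
  have ht : 0 ≤ t := (hs0 y).trans hyt.le
  have hsx : ∀ᶠ z in 𝓝 x, t < s z :=
    hW.1.nhdsWithin_eq hx ▸ hs.lowerSemicontinuousOn x hx t htx
  obtain ⟨B, hB, hxB, hBN⟩ := hN.exists_mem_closure_subset (inter_mem hNx hsx)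
  obtain ⟨ψ, hψ0, hψ1, hψ⟩ := exists_continuous_zero_one_of_isClosed
    (hN.isOpen hB).isClosed_compl (isClosed_singleton (x := x))
    (disjoint_singleton_right.2 fun h => h hxB)
  have habs : ∀ z, ‖t * ψ z‖ ≤ t := fun z => by
    rw [Real.norm_of_nonneg (mul_nonneg ht (hψ z).1)]
    exact mul_le_of_le_one_right ht (hψ z).2
  let φ : X →ᵇ ℝ := .ofNormedAddCommGroup (fun z => t * ψ z) (by fun_prop) t habs
  have hφ0 : EqOn φ 0 (closure B)ᶜ := fun z hz =>
    mul_eq_zero_of_right t (hψ0 fun h => hz (subset_closure h))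
  have hφx : φ x = t := (congrArg (t * ·) (hψ1 rfl)).trans (mul_one t)
  have hφs : ∀ z ∈ W, φ z ≤ s z := fun z _ => by
    by_cases hz : z ∈ closure B
    · exact ((le_abs_self _).trans (habs z)).trans (hBN hz).2.le
    · exact (hφ0 hz).trans_le (hs0 z)
  have htφ : t ≤ ‖φ‖ := hφx ▸ (le_abs_self _).trans (φ.norm_coe_le_norm x)
  have hφt : ‖φ‖ ≤ t := BoundedContinuousFunction.norm_ofNormedAddCommGroup_le _ ht habs
  refine ⟨φ, closure B, hN.compact_closure B hB, hBN.trans inter_subset_left,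
    fun z => mul_nonneg ht (hψ z).1, hφ0, ?_, le_antisymm (reduced_le_norm hN φ x)
      (hφt.trans (hφx.ge.trans (le_reduced hN φ x)))⟩
  exact (reduced_le_of_isLocallySuperharmonic hN hW subset_rfl
    (hs.isLocallySuperharmonic hN hW.1) hφs hy).trans_lt (hyt.trans_le htφ)

theorem harmonic_reduced_sub_sweep (hN : IsNormalBauerFamily 𝒱 H) (hW : IsPSet 𝒱 H W)
    (hV : V ∈ inside 𝒱 W) (hφ : ∀ z, 0 ≤ φ z) (hφC : EqOn φ 0 Cᶜ) :
    Harmonic 𝒱 H (V \ C) fun z => reduced 𝒱 H W φ z - sweep (H V) (reduced 𝒱 H W φ) z := by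
  refine .sub (harmonic_reduced hN hW hW.1 subset_rfl
    (sdiff_subset.trans (subset_closure.trans hV.2)) fun B hB z hz => ?_)
    ((harmonic_sweep hN hV.1 (isBoundedBorel_reduced hN φ)).mono sdiff_subset) hN
  rw [hφC (hB.2 (subset_closure hz)).2]
  exact integral_nonneg fun y => (hφ y).trans (le_reduced hN φ y)

/-- Otherwise `R = H_V R` on `D`, and `‖φ‖ - H_V R` contradicts ellipticity. -/
theorem reduced_sub_sweep_pos (hN : IsNormalBauerFamily 𝒱 H) (hell : IsElliptic 𝒱 H)
    (hW : IsPSet 𝒱 H W) (hV : V ∈ inside 𝒱 W) (hD : IsOpen D) (hDc : IsConnected D) (hDV : D ⊆ V)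
    (hx : x ∈ D) (hy : y ∈ D) (hRy : reduced 𝒱 H W φ y < ‖φ‖) (hRx : reduced 𝒱 H W φ x = ‖φ‖) :
    ∀ z ∈ D, 0 < reduced 𝒱 H W φ z - sweep (H V) (reduced 𝒱 H W φ) z := by
  have hVW : V ⊆ W := subset_closure.trans hV.2
  have := hN.isMarkovKernel hV.1
  have hR := isSuperharmonic_reduced (Ω := W) hN φ
  have hRc := continuousOn_reduced hN hW hW.1 subset_rfl φ
  have hS := (harmonic_sweep hN hV.1 hR.isBoundedBorel).mono hDV
  refine ((hR.mono (hDV.trans hVW)).sub_harmonic hS hN hR.isBoundedBorel.sweep |>.eq_zero_or_pos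
    hell hN hW hD hDc (hDV.trans hVW) ((hRc.mono (hDV.trans hVW)).sub hS.1)
    fun z hz => sub_nonneg.2 (hR.sweep_le V hV z (hDV hz))).resolve_left fun hzero => ?_
  have hle : ∀ z, sweep (H V) (reduced 𝒱 H W φ) z ≤ ‖φ‖ := fun z =>
    (le_abs_self _).trans (abs_sweep_le (abs_reduced_le hN φ) z)
  rcases hell D hD hDc _ ((harmonic_const hN ‖φ‖).sub hS hN) fun z _ => sub_nonneg.2 (hle z)
    with h | h
  · linarith [hzero y hy, h y hy]
  · linarith [hzero x hx, h x hx]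

/-- For the reduced function `R` of a bump function supported in `C`, the function
`q = R - H_V R` is a potential on `V`. -/
theorem exists_potential (hN : IsNormalBauerFamily 𝒱 H) (hell : IsElliptic 𝒱 H)
    (hW : IsPSet 𝒱 H W) (hz : z ∈ W) (hNz : N ∈ 𝓝 z) :
    ∃ V ∈ inside 𝒱 W, closure V ⊆ N ∧ ∃ (q : X → ℝ) (C : Set X), IsCompact C ∧ z ∈ C ∧ C ⊆ V ∧
      ContinuousOn q (closure V) ∧ EqOn q 0 (frontier V) ∧ Harmonic 𝒱 H (V \ C) q ∧
      ∀ y ∈ C, 0 < q y := by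
  obtain ⟨V, hV𝒱, hzV, hcl⟩ := hN.exists_mem_closure_subset (inter_mem hNz (hW.1.mem_nhds hz))
  have hV : V ∈ inside 𝒱 W := ⟨hV𝒱, hcl.trans inter_subset_right⟩
  have hVo := hN.isOpen hV𝒱
  obtain ⟨D, hD, hDc, hzD⟩ := exists_isRelClopen_isConnected hN hW hVo
    (subset_closure.trans hV.2) hzV
  have hDW : D ⊆ W := hD.subset.trans (subset_closure.trans hV.2)
  obtain ⟨s, hs, hs0, x, hx, y, hy, hxy⟩ := hW.exists_isSuperharmonic_lt hN hD.isOpen ⟨z, hzD⟩ hDW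
  obtain ⟨φ, C, hC, hCD, hφ0, hφC, hRy, hRx⟩ := hs.exists_reduced_lt hN hW hs0 (hDW hx) (hDW hy)
    hxy (hD.isOpen.mem_nhds hx)
  have hRc := (continuousOn_reduced hN hW hW.1 subset_rfl φ).mono hV.2
  have hCD' : insert z C ⊆ D := insert_subset hzD hCD
  refine ⟨V, hV, hcl.trans inter_subset_left, _, insert z C, hC.insert z, mem_insert z C,
    hCD'.trans hD.subset, hRc.sub (continuousOn_sweep_closure hN hV𝒱 hRc), fun t ht => ?_,
    (harmonic_reduced_sub_sweep hN hW hV hφ0 hφC).mono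
      (sdiff_subset_sdiff_right (subset_insert z C)),
    fun t ht => reduced_sub_sweep_pos hN hell hW hV hD.isOpen hDc hD.subset hx hy hRy hRx t
      (hCD' ht)⟩
  exact sub_eq_zero.2 ((hN.boundary V hV𝒱).sweep_of_notMem (hVo.frontier_eq ▸ ht).2 _).symm

/-- The superlevel set `B = {q ≥ a}` of a potential `q` has the barrier `a - q`. -/
theorem exists_isClosed_hasBarrierAt (hN : IsNormalBauerFamily 𝒱 H) (hell : IsElliptic 𝒱 H)
    (hW : IsPSet 𝒱 H W) (hz : z ∈ W) (hNz : N ∈ 𝓝 z) :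
    ∃ B ∈ 𝓝 z, IsClosed B ∧ B ⊆ N ∧ ∀ y ∈ frontier B, HasBarrierAt 𝒱 H Bᶜ y := by
  obtain ⟨V, hV, hVN, q, C, hC, hzC, hCV, hqc, hq0, hqh, hqpos⟩ :=
    exists_potential hN hell hW hz hNz
  have hVo := hN.isOpen hV.1
  obtain ⟨b, hbC, hb⟩ := hC.exists_isMinOn ⟨z, hzC⟩ (hqc.mono (hCV.trans subset_closure))
  obtain ⟨a, ha, hab⟩ := exists_between (hqpos b hbC)
  have haC : ∀ y ∈ C, a < q y := fun y hy => hab.trans_le (hb hy)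
  set B := closure V ∩ q ⁻¹' Ici a
  have hB : IsClosed B := hqc.preimage_isClosed_of_isClosed isClosed_closure isClosed_Ici
  have hBV : B ⊆ V := fun y hy => by
    by_contra hyV
    exact ha.not_ge (hy.2.trans_eq (hq0 (hVo.frontier_eq ▸ ⟨hy.1, hyV⟩)))
  have hint : V ∩ q ⁻¹' Ioi a ⊆ interior B := interior_maximal
    (inter_subset_inter subset_closure (preimage_mono Ioi_subset_Ici_self))
    ((hqc.mono subset_closure).isOpen_inter_preimage hVo isOpen_Ioi)
  refine ⟨B, mem_interior_iff_mem_nhds.1 (hint ⟨hCV hzC, haC z hzC⟩), hB,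
    inter_subset_left.trans hVN, fun y hy => ?_⟩
  rw [hB.frontier_eq] at hy
  have hqy : q y = a := le_antisymm (not_lt.1 fun h => hy.2 (hint ⟨hBV hy.1, h⟩)) hy.1.2
  refine ⟨V \ C, fun x => a - q x, hVo.sdiff hC.isClosed, ⟨hBV hy.1, fun h => (haC y h).ne' hqy⟩,
    (harmonic_const hN a).sub hqh hN, sub_eq_zero.2 hqy.symm, fun x hx => sub_pos.2 ?_⟩
  exact not_le.1 fun h => hx.1 ⟨subset_closure hx.2.1, h⟩

theorem exists_isOpen_hasBarrierAt (hN : IsNormalBauerFamily 𝒱 H) (hell : IsElliptic 𝒱 H)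
    (hW : IsPSet 𝒱 H W) (hK : IsCompact K) (hKW : K ⊆ W) :
    ∃ U, IsOpen U ∧ IsCompact (closure U) ∧ K ⊆ U ∧ closure U ⊆ W ∧
      ∀ z ∈ frontier U, HasBarrierAt 𝒱 H U z := by
  obtain ⟨G, hG, hKG, hGW, hGc⟩ := exists_open_between_and_isCompact_closure hK hW.1 hKW
  have hloc : ∀ z ∈ frontier G, ∃ B ∈ 𝓝 z, IsClosed B ∧ B ⊆ Kᶜ ∧
      ∀ y ∈ frontier B, HasBarrierAt 𝒱 H Bᶜ y := fun z hz =>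
    exists_isClosed_hasBarrierAt hN hell hW (hGW (frontier_subset_closure hz))
      (hK.isClosed.isOpen_compl.mem_nhds fun h => (hG.frontier_eq ▸ hz).2 (hKG h))
  choose! B hBz hB hBK hBbar using hloc
  obtain ⟨T, hTG, hT⟩ := (hGc.of_isClosed_subset isClosed_frontier
    frontier_subset_closure).elim_nhds_subcover (fun z => interior (B z))
    fun z hz => interior_mem_nhds.2 (hBz z hz)
  have hUG : closure (G \ ⋃ z ∈ T, B z) ⊆ closure G := closure_mono sdiff_subset
  refine ⟨G \ ⋃ z ∈ T, B z, hG.sdiff (T.finite_toSet.isClosed_biUnion fun z hz => hB z (hTG z hz)),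
    hGc.of_isClosed_subset isClosed_closure hUG, fun x hx => ⟨hKG hx, fun h => ?_⟩, hUG.trans hGW,
    fun y hy => ?_⟩
  · obtain ⟨z, hz, hxz⟩ := mem_iUnion₂.1 h
    exact hBK z (hTG z hz) hxz hx
  · obtain ⟨z, hz, hyz⟩ := mem_iUnion₂.1
      (frontier_diff_biUnion_subset hG (fun z hz => hB z (hTG z hz)) hT hy)
    exact (hBbar z (hTG z hz) y hyz).mono fun x hx hxz => hx.2 (mem_biUnion hz hxz)

end Barriers

section BoundaryBehaviour

variable {X : Type*} [MeasurableSpace X]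

theorem exists_measureReal_inter_preimage_Iio_lt (μ : Measure X) [IsFiniteMeasure μ] {s : Set X}
    (hs : MeasurableSet s) {f : X → ℝ} (hf : Measurable f) (hpos : ∀ᵐ x ∂μ, x ∈ s → 0 < f x)
    {δ : ℝ} (hδ : 0 < δ) : ∃ c > 0, μ.real (s ∩ f ⁻¹' Iio c) < δ := by
  have hlim := tendsto_measure_biInter_gt (μ := μ) (s := fun c => s ∩ f ⁻¹' Iio c) (a := 0)
    (fun c _ => (hs.inter (hf measurableSet_Iio)).nullMeasurableSet)
    (fun c d _ hcd => inter_subset_inter_right s (preimage_mono (Iio_subset_Iio hcd)))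
    ⟨1, one_pos, measure_ne_top μ _⟩
  have hzero : μ (⋂ c > 0, s ∩ f ⁻¹' Iio c) = 0 := by
    refine measure_eq_zero_iff_ae_notMem.2 (hpos.mono fun x hx hxI => ?_)
    have hxc : ∀ c > 0, x ∈ s ∩ f ⁻¹' Iio c := mem_iInter₂.1 hxI
    have hfx := hx (hxc 1 one_pos).1
    exact lt_irrefl (f x) (hxc _ hfx).2
  rw [hzero] at hlim
  obtain ⟨c, hc, hc0⟩ := ((hlim.eventually (gt_mem_nhds (ENNReal.ofReal_pos.2 hδ))).and
    self_mem_nhdsWithin).exists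
  exact ⟨c, hc0, ENNReal.toReal_lt_of_lt_ofReal hc⟩

variable [TopologicalSpace X] [T2Space X] [LocallyCompactSpace X] [SecondCountableTopology X]
  {𝒱 : Set (Set X)} {H : Set X → Kernel X X} {N U V W : Set X} {z : X}

theorem HasBarrierAt.exists_boundedContinuous (hz : HasBarrierAt 𝒱 H U z)
    (hN : IsNormalBauerFamily 𝒱 H) (hNz : N ∈ 𝓝 z) :
    ∃ V ∈ 𝒱, z ∈ V ∧ V ⊆ N ∧ ∃ k : X →ᵇ ℝ, Harmonic 𝒱 H (U ∩ V) k ∧ (∀ x, 0 ≤ k x) ∧ k z = 0 ∧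
      ∀ x ∈ U ∩ closure V, 0 < k x := by
  obtain ⟨N', h, hN', hzN', hh, hhz, hpos⟩ := hz
  obtain ⟨V, hV, hzV, hVN⟩ := hN.exists_mem_closure_subset (inter_mem hNz (hN'.mem_nhds hzN'))
  have hVN' : closure V ⊆ N' := hVN.trans inter_subset_right
  obtain ⟨F, hF⟩ := exists_boundedContinuous_eqOn (hN.compact_closure V hV) (hh.1.mono hVN')
  have hFh : ∀ x ∈ U ∩ closure V, max (F x) 0 = h x := fun x hx => by
    rw [hF hx.2, max_eq_left (hpos x ⟨hx.1, hVN' hx.2⟩).le]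
  refine ⟨V, hV, hzV, subset_closure.trans (hVN.trans inter_subset_left), F ⊔ 0,
    (hh.mono (inter_subset_right.trans (subset_closure.trans hVN'))).congr hN
      fun x hx => hFh x ⟨hx.1, subset_closure hx.2⟩, fun x => le_max_right _ _, ?_,
    fun x hx => (hpos x ⟨hx.1, hVN' hx.2⟩).trans_eq (hFh x hx).symm⟩
  simp [hF (subset_closure hzV), hhz]

variable [BorelSpace X]

/-- For a barrier `k`, the function `g = k / c + H_V 1_O` with `O = {k < c}` has these properties
for `V ∋ z` and `c > 0` small. -/
theorem HasBarrierAt.exists_isSuperharmonic (hz : HasBarrierAt 𝒱 H U z)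
    (hN : IsNormalBauerFamily 𝒱 H) (hU : IsOpen U) (hNz : N ∈ 𝓝 z) {δ : ℝ} (hδ : 0 < δ) :
    ∃ V, IsOpen V ∧ z ∈ V ∧ V ⊆ N ∧ ∃ g : X → ℝ, IsSuperharmonic 𝒱 H (U ∩ V) g ∧
      LowerSemicontinuous g ∧ (∀ x, 0 ≤ g x) ∧ (∀ x ∈ U \ V, 1 ≤ g x) ∧ ContinuousAt g z ∧
      g z < δ := by
  obtain ⟨V, hV, hzV, hVN, k, hk, hk0, hkz, hpos⟩ := hz.exists_boundedContinuous hN hNz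
  have hVo := hN.isOpen hV
  have := hN.isMarkovKernel hV
  obtain ⟨c, hc, hcδ⟩ := exists_measureReal_inter_preimage_Iio_lt (H V z) hU.measurableSet
    k.continuous.measurable (((hN.boundary V hV).ae_mem_frontier hzV).mono fun y hy hyU =>
      hpos y ⟨hyU, frontier_subset_closure hy⟩) hδ
  set O := U ∩ k ⁻¹' Iio c
  have hO : IsOpen O := hU.inter (isOpen_Iio.preimage k.continuous)
  have hOb := isBoundedBorel_indicator hO.measurableSet 1
  have hS := harmonic_sweep hN hV hOb
  have hS0 : ∀ x, 0 ≤ sweep (H V) (O.indicator fun _ => 1) x := fun x =>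
    integral_nonneg fun y => indicator_nonneg (fun _ _ => zero_le_one) y
  have hck : ∀ x, 0 ≤ c⁻¹ * k x := fun x => mul_nonneg (inv_nonneg.2 hc.le) (hk0 x)
  have hkc : Continuous fun x => c⁻¹ * k x := by fun_prop
  refine ⟨V, hVo, hzV, hVN, fun x => c⁻¹ * k x + sweep (H V) (O.indicator fun _ => 1) x,
    ((hk.isSuperharmonic (.of_boundedContinuous k)).const_mul (inv_nonneg.2 hc.le)).add
      ((hS.mono inter_subset_right).isSuperharmonic hOb.sweep) hN,
    hkc.lowerSemicontinuous.add (lowerSemicontinuous_sweep hN hV hOb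
      (hO.lowerSemicontinuous_indicator zero_le_one)), fun x => add_nonneg (hck x) (hS0 x),
    fun x hx => ?_, hkc.continuousAt.add (hS.1.continuousAt (hVo.mem_nhds hzV)), ?_⟩
  · change 1 ≤ c⁻¹ * k x + sweep (H V) (O.indicator fun _ => 1) x
    by_cases hxO : x ∈ O
    · rw [(hN.boundary V hV).sweep_of_notMem hx.2, indicator_of_mem hxO]
      exact le_add_of_nonneg_left (hck x)
    · have hcx : c ≤ k x := not_lt.1 fun hlt => hxO ⟨hx.1, hlt⟩
      exact ((one_le_inv_mul₀ hc).2 hcx).trans (le_add_of_nonneg_right (hS0 x))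
  · change c⁻¹ * k z + sweep (H V) (O.indicator fun _ => 1) z < δ
    rwa [hkz, mul_zero, zero_add, sweep, integral_indicator_const _ hO.measurableSet, smul_eq_mul,
      mul_one]

theorem reduced_le_add_norm_mul (hN : IsNormalBauerFamily 𝒱 H) (hW : IsPSet 𝒱 H W) (hU : IsOpen U)
    (hUW : U ⊆ W) (hV : IsOpen V) {g : X → ℝ} (hg : IsSuperharmonic 𝒱 H (U ∩ V) g)
    (hgl : LowerSemicontinuousOn g U) (hg0 : ∀ x ∈ U, 0 ≤ g x) (hg1 : ∀ x ∈ U \ V, 1 ≤ g x)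
    {φ : X →ᵇ ℝ} {a : ℝ} (ha : -‖φ‖ ≤ a) (hφ : ∀ x ∈ U ∩ V, φ x ≤ a) {x : X} (hx : x ∈ U) :
    reduced 𝒱 H U φ x ≤ a + 2 * ‖φ‖ * g x := by
  let e : X → ℝ := fun x => a + 2 * ‖φ‖ * g x
  have he : IsSuperharmonic 𝒱 H (U ∩ V) e :=
    (isSuperharmonic_const hN a).add (hg.const_mul (by positivity)) hN
  have hel : LowerSemicontinuousOn e U := lowerSemicontinuousOn_const.add
    ((continuous_const_mul _).comp_lowerSemicontinuousOn hgl
      fun _ _ h => mul_le_mul_of_nonneg_left h (by positivity))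
  have hae : ∀ y ∈ U, a ≤ e y := fun y hy =>
    le_add_of_nonneg_right (mul_nonneg (by positivity) (hg0 y hy))
  have heV : ∀ y ∈ U \ V, ‖φ‖ ≤ e y := fun y hy => by
    have := mul_le_mul_of_nonneg_left (hg1 y hy) (by positivity : 0 ≤ 2 * ‖φ‖)
    simp only [e]
    linarith
  have hs := (isSuperharmonic_const (Ω := U) hN ‖φ‖).isLocallySuperharmonic_min he hN hU hV hel heV
  refine (reduced_le_of_isLocallySuperharmonic hN hW hUW hs (fun y hy => ?_) hx).trans
    (min_le_right _ _)
  have hφy := (abs_le.1 (φ.norm_coe_le_norm y)).2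
  by_cases hyV : y ∈ V
  · exact le_min hφy ((hφ y ⟨hy, hyV⟩).trans (hae y hy))
  · exact le_min hφy (hφy.trans (heV y ⟨hy, hyV⟩))

theorem HasBarrierAt.eventually_reduced_lt (hz : HasBarrierAt 𝒱 H U z)
    (hN : IsNormalBauerFamily 𝒱 H) (hW : IsPSet 𝒱 H W) (hU : IsOpen U) (hUW : U ⊆ W) (φ : X →ᵇ ℝ)
    {ε : ℝ} (hε : 0 < ε) : ∀ᶠ x in 𝓝 z, x ∈ U → reduced 𝒱 H U φ x < φ z + ε := by
  have hφN : {x | φ x < φ z + ε / 2} ∈ 𝓝 z :=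
    φ.continuous.continuousAt.eventually (gt_mem_nhds (lt_add_of_pos_right _ (half_pos hε)))
  obtain ⟨V, hV, -, hφV, g, hg, hgl, hg0, hg1, hgc, hgz⟩ := hz.exists_isSuperharmonic hN hU hφN
    (δ := ε / (4 * (‖φ‖ + 1))) (by positivity)
  have hle : ∀ x ∈ U, reduced 𝒱 H U φ x ≤ φ z + ε / 2 + 2 * ‖φ‖ * g x := fun x hx =>
    reduced_le_add_norm_mul hN hW hU hUW hV hg (hgl.lowerSemicontinuousOn U) (fun y _ => hg0 y) hg1
      (by linarith [(abs_le.1 (φ.norm_coe_le_norm z)).1]) (fun y hy => (hφV hy.2).le) hx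
  have hlt : φ z + ε / 2 + 2 * ‖φ‖ * g z < φ z + ε := by
    have hφδ : 2 * ‖φ‖ * (ε / (4 * (‖φ‖ + 1))) < ε / 2 := by
      rw [mul_div_assoc', div_lt_iff₀ (by positivity)]
      linarith
    linarith [mul_le_mul_of_nonneg_left hgz.le (by positivity : 0 ≤ 2 * ‖φ‖)]
  have hcont : ContinuousAt (fun x => φ z + ε / 2 + 2 * ‖φ‖ * g x) z :=
    continuousAt_const.add (hgc.const_mul (2 * ‖φ‖))
  filter_upwards [hcont.eventually (gt_mem_nhds hlt)] with x hx hxU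
  exact (hle x hxU).trans_lt hx

theorem HasBarrierAt.continuousAt_reduced (hz : HasBarrierAt 𝒱 H U z)
    (hN : IsNormalBauerFamily 𝒱 H) (hW : IsPSet 𝒱 H W) (hU : IsOpen U) (hUW : U ⊆ W) (hzU : z ∉ U)
    (φ : X →ᵇ ℝ) : ContinuousAt (reduced 𝒱 H U φ) z := by
  rw [Metric.continuousAt_iff']
  intro ε hε
  filter_upwards [hz.eventually_reduced_lt hN hW hU hUW φ hε,
    Metric.continuousAt_iff'.1 φ.continuous.continuousAt ε hε] with x hlt hφx
  rw [reduced_eq_of_notMem hN φ hzU]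
  by_cases hxU : x ∈ U
  · rw [Real.dist_eq, abs_lt] at hφx ⊢
    constructor <;> linarith [hlt hxU, le_reduced (Ω := U) hN φ x]
  · rwa [reduced_eq_of_notMem hN φ hxU]

end BoundaryBehaviour

section DirichletProblem

variable {X : Type*} [TopologicalSpace X] [MeasurableSpace X]
  {𝒱 : Set (Set X)} {H : Set X → Kernel X X} {U W : Set X} {f g : X → ℝ}

/-- The Dirichlet problem on `U` with boundary values `f` has a solution. -/
def IsSolvable (𝒱 : Set (Set X)) (H : Set X → Kernel X X) (U : Set X) (f : X → ℝ) : Prop :=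
  ∃ h, ContinuousOn h (closure U) ∧ EqOn h f (frontier U) ∧ Harmonic 𝒱 H U h

/-- Bounded Borel functions on `X` which are continuous and superharmonic on `Ω`. -/
structure IsContinuousSuperharmonic (𝒱 : Set (Set X)) (H : Set X → Kernel X X) (Ω : Set X)
    (p : X → ℝ) : Prop where
  isSuperharmonic : IsSuperharmonic 𝒱 H Ω p
  continuousOn : ContinuousOn p Ω

namespace IsContinuousSuperharmonic

variable {p q : X → ℝ}

theorem const (hN : IsNormalBauerFamily 𝒱 H) (c : ℝ) :
    IsContinuousSuperharmonic 𝒱 H W fun _ => c :=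
  ⟨isSuperharmonic_const hN c, continuousOn_const⟩

theorem add (hp : IsContinuousSuperharmonic 𝒱 H W p) (hq : IsContinuousSuperharmonic 𝒱 H W q)
    (hN : IsNormalBauerFamily 𝒱 H) : IsContinuousSuperharmonic 𝒱 H W fun x => p x + q x :=
  ⟨hp.1.add hq.1 hN, hp.2.add hq.2⟩

theorem const_mul (hp : IsContinuousSuperharmonic 𝒱 H W p) {c : ℝ} (hc : 0 ≤ c) :
    IsContinuousSuperharmonic 𝒱 H W fun x => c * p x :=
  ⟨hp.1.const_mul hc, continuousOn_const.mul hp.2⟩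

theorem inf (hp : IsContinuousSuperharmonic 𝒱 H W p) (hq : IsContinuousSuperharmonic 𝒱 H W q)
    (hN : IsNormalBauerFamily 𝒱 H) : IsContinuousSuperharmonic 𝒱 H W fun x => min (p x) (q x) :=
  ⟨hp.1.inf hq.1 hN, hp.2.inf hq.2⟩

end IsContinuousSuperharmonic

variable [T2Space X] [BorelSpace X]

theorem IsSolvable.sub (hf : IsSolvable 𝒱 H U f) (hg : IsSolvable 𝒱 H U g)
    (hN : IsNormalBauerFamily 𝒱 H) : IsSolvable 𝒱 H U fun x => f x - g x := by
  obtain ⟨h, hc, hb, hh⟩ := hf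
  obtain ⟨k, kc, kb, hk⟩ := hg
  exact ⟨fun x => h x - k x, hc.sub kc, fun x hx => congrArg₂ (· - ·) (hb hx) (kb hx),
    hh.sub hk hN⟩

variable [LocallyCompactSpace X] [SecondCountableTopology X]

/-- The solution is the reduced function of `-p` on `U`, which is harmonic because `-p` is
subharmonic. -/
theorem IsContinuousSuperharmonic.isSolvable_neg {p : X → ℝ}
    (hp : IsContinuousSuperharmonic 𝒱 H W p) (hN : IsNormalBauerFamily 𝒱 H) (hW : IsPSet 𝒱 H W)
    (hU : IsOpen U) (hUc : IsCompact (closure U)) (hUW : closure U ⊆ W)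
    (hb : ∀ z ∈ frontier U, HasBarrierAt 𝒱 H U z) : IsSolvable 𝒱 H U fun x => -p x := by
  obtain ⟨φ, hφ⟩ := exists_boundedContinuous_eqOn hUc (hp.continuousOn.mono hUW).neg
  have hUW' : U ⊆ W := subset_closure.trans hUW
  refine ⟨reduced 𝒱 H U φ, fun x hx => ContinuousAt.continuousWithinAt ?_, fun x hx => ?_,
    harmonic_reduced hN hW hU hUW' subset_rfl fun V hV x hx => ?_⟩
  · by_cases hxU : x ∈ U
    · exact (continuousOn_reduced hN hW hU hUW' φ).continuousAt (hU.mem_nhds hxU)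
    · exact (hb x (hU.frontier_eq ▸ ⟨hx, hxU⟩)).continuousAt_reduced hN hW hU hUW' hxU φ
  · rw [reduced_eq_of_notMem hN φ (hU.frontier_eq ▸ hx).2]
    exact hφ (frontier_subset_closure hx)
  · have := hN.isMarkovKernel hV.1
    have hVU : closure V ⊆ closure U := hV.2.trans subset_closure
    calc φ x = -p x := hφ (hVU (subset_closure hx))
      _ ≤ -sweep (H V) p x := neg_le_neg (hp.1.sweep_le V (inside_mono hUW' hV) x hx)
      _ = sweep (H V) (fun y => -p y) x := (integral_neg p).symm
      _ = sweep (H V) φ x := (hN.boundary V hV.1).sweep_congr hx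
        (hφ.mono (frontier_subset_closure.trans hVU)).symm
      _ ≤ sweep (H V) (reduced 𝒱 H U φ) x := sweep_mono (IsBoundedBorel.of_boundedContinuous φ)
        (isBoundedBorel_reduced hN φ) (le_reduced hN φ) x

theorem IsPSet.exists_isContinuousSuperharmonic_ne (hW : IsPSet 𝒱 H W)
    (hN : IsNormalBauerFamily 𝒱 H) {x y : X} (hx : x ∈ W) (hy : y ∈ W) (hxy : x ≠ y) :
    ∃ p, IsContinuousSuperharmonic 𝒱 H W p ∧ p x ≠ p y := by
  obtain ⟨s, hs, hs0, hne⟩ := hW.exists_isSuperharmonic_ne hN hx hy hxy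
  wlog hlt : s y < s x generalizing x y
  · obtain ⟨p, hp, hpne⟩ := this hy hx hxy.symm hne.symm (hne.lt_of_le (not_lt.1 hlt))
    exact ⟨p, hp, hpne.symm⟩
  obtain ⟨φ, -, -, -, -, -, hlt, heq⟩ := hs.exists_reduced_lt hN hW hs0 hx hy hlt univ_mem
  exact ⟨reduced 𝒱 H W φ,
    ⟨isSuperharmonic_reduced hN φ, continuousOn_reduced hN hW hW.1 subset_rfl φ⟩,
    (heq.symm ▸ hlt).ne'⟩

theorem IsPSet.exists_sub_eq (hW : IsPSet 𝒱 H W) (hN : IsNormalBauerFamily 𝒱 H) {x y : X}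
    (hx : x ∈ W) (hy : y ∈ W) (hxy : x ≠ y) (a b : ℝ) :
    ∃ p q, IsContinuousSuperharmonic 𝒱 H W p ∧ IsContinuousSuperharmonic 𝒱 H W q ∧
      p x - q x = a ∧ p y - q y = b := by
  obtain ⟨p, hp, hpne⟩ := hW.exists_isContinuousSuperharmonic_ne hN hx hy hxy
  have hα : (a - b) / (p x - p y) * (p x - p y) = a - b :=
    div_mul_cancel₀ _ (sub_ne_zero.2 hpne)
  set α := (a - b) / (p x - p y)
  rcases le_total 0 α with h | h
  · refine ⟨_, _, (hp.const_mul h).add (.const hN (a - α * p x)) hN, .const hN 0, ?_, ?_⟩ <;>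
      linarith
  · refine ⟨_, _, .const hN (a - α * p x), hp.const_mul (neg_nonneg.2 h), ?_, ?_⟩ <;> linarith

/-- The differences of continuous superharmonic functions form a lattice, so the Stone–Weierstrass
theorem applies. -/
theorem IsPSet.exists_abs_sub_sub_lt (hW : IsPSet 𝒱 H W) (hN : IsNormalBauerFamily 𝒱 H)
    {B : Set X} (hB : IsCompact B) (hBW : B ⊆ W) (hf : ContinuousOn f B) {ε : ℝ} (hε : 0 < ε) :
    ∃ p q, IsContinuousSuperharmonic 𝒱 H W p ∧ IsContinuousSuperharmonic 𝒱 H W q ∧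
      ∀ x ∈ B, |p x - q x - f x| < ε := by
  have := isCompact_iff_compactSpace.1 hB
  let L : Set C(B, ℝ) := {F | ∃ p q, IsContinuousSuperharmonic 𝒱 H W p ∧
    IsContinuousSuperharmonic 𝒱 H W q ∧ ∀ x : B, F x = p x - q x}
  have hL : closure L = ⊤ := by
    refine ContinuousMap.sublattice_closure_eq_top L
      ⟨0, fun _ => 0, fun _ => 0, .const hN 0, .const hN 0, by simp⟩ ?_ ?_ fun v x y => ?_
    · rintro F ⟨p, q, hp, hq, hF⟩ G ⟨r, t, hr, ht, hG⟩
      refine ⟨_, _, (hp.add ht hN).inf (hr.add hq hN) hN, hq.add ht hN, fun x => ?_⟩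
      rw [ContinuousMap.inf_apply, hF, hG, ← min_sub_sub_right]
      congr 1 <;> ring
    · rintro F ⟨p, q, hp, hq, hF⟩ G ⟨r, t, hr, ht, hG⟩
      refine ⟨_, _, hp.add hr hN, (hp.add ht hN).inf (hr.add hq hN) hN, fun x => ?_⟩
      rw [ContinuousMap.sup_apply, hF, hG, ← max_sub_sub_left, max_comm]
      congr 1 <;> ring
    · rcases eq_or_ne x y with rfl | hxy
      · exact ⟨.const _ (v x), ⟨_, _, .const hN (v x), .const hN 0, by simp⟩, rfl, rfl⟩
      · obtain ⟨p, q, hp, hq, hpx, hpy⟩ := hW.exists_sub_eq hN (hBW x.2) (hBW y.2)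
          (Subtype.coe_injective.ne hxy) (v x) (v y)
        exact ⟨⟨_, ((hp.2.sub hq.2).mono hBW).domRestrict⟩, ⟨p, q, hp, hq, fun _ => rfl⟩, hpx, hpy⟩
  let f' : C(B, ℝ) := ⟨_, hf.domRestrict⟩
  have hfL : f' ∈ closure L := hL.symm ▸ mem_univ f'
  obtain ⟨F, ⟨p, q, hp, hq, hF⟩, hFf⟩ := Metric.mem_closure_iff.1 hfL ε hε
  refine ⟨p, q, hp, hq, fun x hx => ?_⟩
  rw [← hF ⟨x, hx⟩, ← Real.dist_eq, dist_comm]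
  exact (ContinuousMap.dist_apply_le_dist (f := f') ⟨x, hx⟩).trans_lt hFf

theorem Harmonic.abs_sub_le (hg : Harmonic 𝒱 H U g) (hf : Harmonic 𝒱 H U f)
    (hN : IsNormalBauerFamily 𝒱 H) (hW : IsPSet 𝒱 H W) (hU : IsOpen U)
    (hUc : IsCompact (closure U)) (hUW : closure U ⊆ W) (hgc : ContinuousOn g (closure U))
    (hfc : ContinuousOn f (closure U)) {C : ℝ} (hC : ∀ z ∈ frontier U, |g z - f z| ≤ C) :
    ∀ x ∈ closure U, |g x - f x| ≤ C := by
  have key : ∀ {h k : X → ℝ}, Harmonic 𝒱 H U h → Harmonic 𝒱 H U k →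
      ContinuousOn h (closure U) → ContinuousOn k (closure U) →
      (∀ z ∈ frontier U, |h z - k z| ≤ C) → ∀ x ∈ closure U, h x - k x ≤ C :=
    fun hh hk hhc hkc hhk x hx => sub_nonneg.1 <|
      ((harmonic_const hN C).sub (hh.sub hk hN) hN).nonneg hN hW hU hUc hUW
        (continuousOn_const.sub (hhc.sub hkc)) (fun z hz => sub_nonneg.2 (le_of_abs_le (hhk z hz)))
        x hx
  exact fun x hx => abs_sub_le_iff.2 ⟨key hg hf hgc hfc hC x hx,
    key hf hg hfc hgc (fun z hz => abs_sub_comm (f z) (g z) ▸ hC z hz) x hx⟩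

theorem isSolvable_of_forall_exists_abs_sub_lt (hN : IsNormalBauerFamily 𝒱 H) (hW : IsPSet 𝒱 H W)
    (hU : IsOpen U) (hUc : IsCompact (closure U)) (hUW : closure U ⊆ W)
    (hf : ∀ ε > 0, ∃ g, IsSolvable 𝒱 H U g ∧ ∀ z ∈ frontier U, |g z - f z| < ε) :
    IsSolvable 𝒱 H U f := by
  obtain ⟨ε, -, hε0, hε⟩ := exists_seq_strictAnti_tendsto (0 : ℝ)
  choose g hg hgf using fun n => hf (ε n) (hε0 n)
  choose h hc hb hh using hg
  have hbd : ∀ n, ∀ z ∈ frontier U, dist (h n z) (f z) < ε n := fun n z hz => by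
    rw [hb n hz, Real.dist_eq]
    exact hgf n z hz
  have hcauchy : UniformCauchySeqOn h atTop (closure U) := by
    rw [Metric.uniformCauchySeqOn_iff]
    intro δ hδ
    obtain ⟨n₀, hn₀⟩ := eventually_atTop.1 (hε.eventually (gt_mem_nhds (half_pos hδ)))
    refine ⟨n₀, fun m hm n hn x hx => lt_of_le_of_lt ?_
      ((add_lt_add (hn₀ m hm) (hn₀ n hn)).trans_eq (add_halves δ))⟩
    refine (hh m).abs_sub_le (hh n) hN hW hU hUc hUW (hc m) (hc n) (fun z hz => ?_) x hx
    exact (dist_triangle_right (h m z) (h n z) (f z)).trans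
      (add_le_add (hbd m z hz).le (hbd n z hz).le)
  have hlim : ∀ x ∈ closure U,
      Tendsto (fun n => h n x) atTop (𝓝 (limUnder atTop fun n => h n x)) :=
    fun x hx => tendsto_nhds_limUnder (cauchySeq_tendsto_of_complete (hcauchy.cauchySeq hx))
  have hunif := hcauchy.tendstoUniformlyOn_of_tendsto hlim
  refine ⟨_, hunif.continuousOn (.of_forall hc), fun z hz => ?_,
    harmonic_of_tendstoUniformlyOn hN hh (hunif.mono subset_closure)⟩
  exact tendsto_nhds_unique (hlim z (frontier_subset_closure hz))
    (tendsto_iff_dist_tendsto_zero.2 (squeeze_zero (fun _ => dist_nonneg)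
      (fun n => (hbd n z hz).le) hε))

theorem isRegular_of_hasBarrierAt (hN : IsNormalBauerFamily 𝒱 H) (hW : IsPSet 𝒱 H W)
    (hU : IsOpen U) (hUc : IsCompact (closure U)) (hUW : closure U ⊆ W)
    (hb : ∀ z ∈ frontier U, HasBarrierAt 𝒱 H U z) : IsRegular 𝒱 H U := by
  refine ⟨hU, hUc, fun f hf => ?_⟩
  have hsolv : IsSolvable 𝒱 H U f := by
    refine isSolvable_of_forall_exists_abs_sub_lt hN hW hU hUc hUW fun ε hε => ?_
    obtain ⟨p, q, hp, hq, hpq⟩ := hW.exists_abs_sub_sub_lt hN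
      (hUc.of_isClosed_subset isClosed_frontier frontier_subset_closure)
      (frontier_subset_closure.trans hUW) hf hε
    have := (hq.isSolvable_neg hN hW hU hUc hUW hb).sub (hp.isSolvable_neg hN hW hU hUc hUW hb) hN
    exact ⟨_, this, fun z hz => by simpa [neg_add_eq_sub] using hpq z hz⟩
  obtain ⟨h, hc, hhf, hh⟩ := hsolv
  exact ⟨h, ⟨hc, hhf, hh⟩, fun k kc hkf hk =>
    hk.eqOn_closure hh hN hW hU hUc hUW kc hc (hkf.trans hhf.symm),
    fun hf0 => hh.nonneg hN hW hU hUc hUW hc fun z hz => (hf0 z hz).trans_eq (hhf hz).symm⟩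

end DirichletProblem

end Bauer

theorem corollary5p3 {X : Type*} [TopologicalSpace X] [T2Space X] [LocallyCompactSpace X]
    [SecondCountableTopology X] [MeasurableSpace X] [BorelSpace X]
    (𝒱 : Set (Set X)) (H : Set X → ProbabilityTheory.Kernel X X)
    (hH : Bauer.IsNormalBauerFamily 𝒱 H) (hell : Bauer.IsElliptic 𝒱 H)
    (W : Set X) (hW : Bauer.IsPSet 𝒱 H W) (K : Set X) (hK : IsCompact K) (hKW : K ⊆ W) :
    ∃ U : Set X, Bauer.IsRegular 𝒱 H U ∧ K ⊆ U ∧ closure U ⊆ W := by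
  obtain ⟨U, hU, hUc, hKU, hUW, hb⟩ := Bauer.exists_isOpen_hasBarrierAt hH hell hW hK hKW
  exact ⟨U, Bauer.isRegular_of_hasBarrierAt hH hW hU hUc hUW hb, hKU, hUW⟩
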